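/- Let $W$ be a simply laced Coxeter group (all $m_{ij}\le 3$) with generators $s_i$ ($i\in I$), acting on the real vector space $V$ with basis the simple roots $\alpha_i$ ($i\in I$) by $s_i v = v-2B(v,\alpha_i)\alpha_i$, where $B$ is the symmetric bilinear form with $B(\alpha_i,\alpha_j)=-\cos(\pi/m_{ij})$. Let $\Phi=\{w\alpha_i\}$ be the root system, $\Phi^+$ the set of roots with nonnegative coefficients on the simple roots, $\Phi^-=-\Phi^+$, and $\Phi(w)=\Phi^+\cap w^{-1}(\Phi^-)$ for $w\in W$. A *root sequence* for $w$ is a sequence $(r_1,\dots,r_k)$ with $r_l=s_{i_k}\cdots s_{i_{k-l+2}}(\alpha_{i_{k-l+1}})$, where $i_1\cdots i_k$ is a reduced expression for $w$. An *inversion triple* of $w$ is a subset of $\Phi(w)$ of the form $\{\alpha,\beta,\alpha+\beta\}$; it is *contractible* if its elements appear consecutively, in some order, in some root sequence for $w$. Let $N(w)$ be the number of contractible inversion triples of $w$. The element $w$ is *freely braided* if its contractible inversion triples are pairwise disjoint, and a freely braided $w$ is *content maximal* if $\#\mathrm{supp}(w)=\ell(w)-N(w)$, where $\mathrm{supp}(w)$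 is the set of letters occurring in reduced expressions for $w$ and $\ell$ is the length function. **Theorem 4.2.** Let $a_n$ ($n\ge1$), $d_n$ ($n\ge4$) and $e_n$ ($n\ge6$) be the numbers of content maximal elements in the Coxeter groups of type $A_n$, $D_n$ and $E_n$ respectively, where for every $n\ge 6$ the Coxeter graph of type $E_n$ is the tree on $n$ vertices consisting of a branch vertex with three arms of $1$, $2$ and $n-4$ vertices (so the group is infinite for $n\ge9$). All these numbers are finite, and as formal power series $$\sum_{n\ge1}a_nx^n=\frac{2x-x^3}{1-3x-x^2+x^3}=2x+6x^2+19x^3+61x^4+196x^5+\cdots,$$ $$\sum_{n\ge4}d_nx^n=\frac{62x^4+15x^5-19x^6}{1-3x-x^2+x^3}=62x^4+201x^5+646x^6+2077x^7+\cdots,$$ $$\sum_{n\ge6}e_nx^n=\frac{652x^6+140x^7-201x^8}{1-3x-x^2+x^3}=652x^6+2096x^7+6739x^8+\cdots.$$ -/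

import Mathlib

open scoped PowerSeries

noncomputable section

namespace CoxeterSystem

/-! ### The reflection representation -/

section Representation

variable {B : Type*} {W : Type*} [Group W] {M : CoxeterMatrix B}

/-- The simple root `α i`, a basis vector of the real vector space `B →₀ ℝ`. -/
def simpleRoot (i : B) : B →₀ ℝ := Finsupp.single i 1

/-- The Coxeter form: the bilinear form with `⟨α i, α j⟩ = - cos (π / M i j)`.
(When `M i j = 0`, i.e. when the order is infinite, this is the usual value `-1`.) -/
def coxeterForm (M : CoxeterMatrix B) : (B →₀ ℝ) →ₗ[ℝ] (B →₀ ℝ) →ₗ[ℝ] ℝ :=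
  Finsupp.linearCombination ℝ fun i =>
    Finsupp.linearCombination ℝ fun j => -Real.cos (Real.pi / (M i j : ℝ))

/-- The linear reflection `v ↦ v - 2 ⟨v, α i⟩ α i`. -/
def simpleReflection (M : CoxeterMatrix B) (i : B) : Module.End ℝ (B →₀ ℝ) :=
  LinearMap.id -
    ((2 : ℝ) • (coxeterForm M).flip (simpleRoot i)).smulRight (simpleRoot i)

theorem coxeterForm_simpleRoot (i j : B) :
    coxeterForm M (simpleRoot i) (simpleRoot j) = -Real.cos (Real.pi / (M i j : ℝ)) := by
  simp [coxeterForm, simpleRoot]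

theorem simpleReflection_apply (i : B) (v : B →₀ ℝ) :
    simpleReflection M i v =
      v - (2 * coxeterForm M v (simpleRoot i)) • simpleRoot i := by
  simp [simpleReflection]

/-- Two reflections whose pairings both equal `-2 cos (π / m)`, `m ≠ 1`, generate a group in which
the `m`-th power of their product is trivial. -/
theorem reflection_mul_reflection_pow_eq_one {V : Type*} [AddCommGroup V] [Module ℝ V]
    {x y : V} {f g : Module.Dual ℝ V} (hf : f x = 2) (hg : g y = 2) (m : ℕ) (hm : m ≠ 1)
    (hfy : f y = -2 * Real.cos (Real.pi / (m : ℝ)))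
    (hgx : g x = -2 * Real.cos (Real.pi / (m : ℝ))) :
    (Module.reflection hf * Module.reflection hg) ^ m = 1 := by
  obtain rfl | hm0 := eq_or_ne m 0
  · simp
  obtain rfl | hm2 := eq_or_ne m 2
  · have h0 : Real.cos (Real.pi / ((2 : ℕ) : ℝ)) = 0 := by simp
    rw [h0] at hfy hgx
    ext1 z
    simp only [pow_two, LinearEquiv.mul_apply, Module.reflection_apply, map_sub, map_smul, hf, hg,
      hfy, hgx, LinearEquiv.coe_one, id_eq]
    match_scalars <;> simp <;> ring
  have hm3 : 3 ≤ m := by omega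
  have hmR : (3 : ℝ) ≤ m := by exact_mod_cast hm3
  set θ : ℝ := 2 * Real.pi / m with hθ
  have hsin : Real.sin θ ≠ 0 := by
    apply ne_of_gt
    apply Real.sin_pos_of_pos_of_lt_pi
    · positivity
    · rw [hθ, div_lt_iff₀ (by linarith)]
      nlinarith [Real.pi_pos]
  have ht : f y * g x - 2 = 2 * Real.cos θ := by
    have : θ = 2 * (Real.pi / m) := by rw [hθ]; ring
    rw [hfy, hgx, this, Real.cos_two_mul]
    ring
  have hS := fun k : ℤ => Polynomial.Chebyshev.S_two_mul_real_cos θ k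
  ext1 z
  rw [Module.reflection_mul_reflection_pow_apply hf hg m z (2 * Real.cos θ) ht.symm]
  obtain ⟨k, hk⟩ := Nat.even_or_odd' m
  rcases hk with hk | hk
  · have e1 : ((m : ℤ) - 2) / 2 = k - 1 := by omega
    have e2 : ((m : ℤ) - 1) / 2 = k - 1 := by omega
    have hz : (Polynomial.Chebyshev.S ℝ (k - 1)).eval (2 * Real.cos θ) = 0 := by
      have h := hS (k - 1)
      have hkθ : (((k - 1 : ℤ) : ℝ) + 1) * θ = Real.pi := by
        have : (m : ℝ) = 2 * k := by exact_mod_cast hk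
        have hk0 : (k : ℝ) ≠ 0 := by intro h; rw [h] at this; linarith
        rw [hθ, this]
        push_cast
        field_simp
        ring
      rw [hkθ, Real.sin_pi] at h
      exact (mul_eq_zero.mp h).resolve_right hsin
    simp [e1, e2, hz]
  · have e1 : ((m : ℤ) - 2) / 2 = k - 1 := by omega
    have e2 : ((m : ℤ) - 1) / 2 = k := by omega
    have e3 : ((m : ℤ) - 3) / 2 = k - 1 := by omega
    have e4 : (m : ℤ) / 2 = k := by omega
    have hz : (Polynomial.Chebyshev.S ℝ k).eval (2 * Real.cos θ)
        + (Polynomial.Chebyshev.S ℝ (k - 1)).eval (2 * Real.cos θ) = 0 := by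
      have h := hS k
      have h' := hS (k - 1)
      have hkθ : (((k : ℤ) : ℝ) + 1) * θ = 2 * Real.pi - (((k - 1 : ℤ) : ℝ) + 1) * θ := by
        have : (m : ℝ) = 2 * k + 1 := by exact_mod_cast hk
        have hm' : (2 * (k : ℝ) + 1) ≠ 0 := by positivity
        rw [hθ, this]
        push_cast
        field_simp
        ring
      rw [hkθ, Real.sin_two_pi_sub] at h
      have : ((Polynomial.Chebyshev.S ℝ k).eval (2 * Real.cos θ)
        + (Polynomial.Chebyshev.S ℝ (k - 1)).eval (2 * Real.cos θ)) * Real.sin θ = 0 := by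
        rw [add_mul, h, h']
        ring
      exact (mul_eq_zero.mp this).resolve_right hsin
    simp [e1, e2, e3, e4, hz]

/-- The simple reflections satisfy the Coxeter relations. -/
theorem isLiftable_simpleReflection (M : CoxeterMatrix B) :
    M.IsLiftable (simpleReflection M) := by
  intro i j
  set f : Module.Dual ℝ (B →₀ ℝ) := (2 : ℝ) • (coxeterForm M).flip (simpleRoot i) with hfdef
  set g : Module.Dual ℝ (B →₀ ℝ) := (2 : ℝ) • (coxeterForm M).flip (simpleRoot j) with hgdef
  have hf : f (simpleRoot i) = 2 := by simp [hfdef, coxeterForm_simpleRoot]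
  have hg : g (simpleRoot j) = 2 := by simp [hgdef, coxeterForm_simpleRoot]
  have key : (Module.reflection hf * Module.reflection hg) ^ M i j = 1 := by
    rcases eq_or_ne i j with rfl | hij
    · rw [M.diagonal, pow_one]
      exact LinearEquiv.ext fun z => Module.involutive_reflection hf z
    · refine reflection_mul_reflection_pow_eq_one hf hg _ (M.off_diagonal i j hij) ?_ ?_
      · simp [hfdef, coxeterForm_simpleRoot, M.symmetric j i]
      · simp [hgdef, coxeterForm_simpleRoot]
  have h1 : simpleReflection M i = (Module.reflection hf).toLinearMap := by
    refine LinearMap.ext fun v => ?_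
    simp [simpleReflection, Module.reflection_apply, hfdef]
  have h2 : simpleReflection M j = (Module.reflection hg).toLinearMap := by
    refine LinearMap.ext fun v => ?_
    simp [simpleReflection, Module.reflection_apply, hgdef]
  have h3 := congrArg LinearEquiv.automorphismGroup.toLinearMapMonoidHom key
  simp only [map_pow, map_mul, map_one] at h3
  rw [h1, h2]
  exact h3

/-- The reflection representation of the Coxeter group `W` on `B →₀ ℝ`; the generator `s i` acts
by `v ↦ v - 2 ⟨v, α i⟩ α i`. -/
def reflectionRep (cs : CoxeterSystem M W) : W →* Module.End ℝ (B →₀ ℝ) :=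
  cs.lift ⟨simpleReflection M, isLiftable_simpleReflection M⟩

theorem reflectionRep_simple (cs : CoxeterSystem M W) (i : B) :
    cs.reflectionRep (cs.simple i) = simpleReflection M i :=
  cs.lift_apply_simple (isLiftable_simpleReflection M) i

end Representation

/-! ### Roots, inversion sets and content maximal elements -/

section Roots

variable {B : Type*} {W : Type*} [Group W] {M : CoxeterMatrix B} (cs : CoxeterSystem M W)

/-- The root system: all vectors `w (α i)`. -/
def roots : Set (B →₀ ℝ) := {β | ∃ (w : W) (i : B), β = cs.reflectionRep w (simpleRoot i)}

/-- The roots all of whose coefficients on the simple roots are nonnegative. -/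
def positiveRoots : Set (B →₀ ℝ) := {β | β ∈ cs.roots ∧ ∀ i, 0 ≤ β i}

/-- The negatives of the positive roots. -/
def negativeRoots : Set (B →₀ ℝ) := {β | -β ∈ cs.positiveRoots}

/-- The inversion set of `w`: the positive roots sent by `w` to negative roots. -/
def inversionSet (w : W) : Set (B →₀ ℝ) :=
  {β | β ∈ cs.positiveRoots ∧ cs.reflectionRep w β ∈ cs.negativeRoots}

/-- The sequence `(r₁, …, rₙ)` attached to a word `i₁ i₂ ⋯ iₙ`: `r₁ = α iₙ`, and in general
`rₗ = s iₙ ⋯ s iₙ₋ₗ₊₂ (α iₙ₋ₗ₊₁)`. The first letter `i₁` of the word contributes the last term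
`rₙ = (s i₂ ⋯ s iₙ)⁻¹ (α i₁)`. -/
def rootSeq : List B → List (B →₀ ℝ)
  | [] => []
  | i :: ω => rootSeq ω ++ [cs.reflectionRep (cs.wordProd ω)⁻¹ (simpleRoot i)]

/-- `r` is a root sequence for `w`: the root sequence of some reduced expression for `w`. -/
def IsRootSeq (w : W) (r : List (B →₀ ℝ)) : Prop :=
  ∃ ω : List B, cs.IsReduced ω ∧ cs.wordProd ω = w ∧ r = cs.rootSeq ω

/-- `T` is an inversion triple of `w`: a subset of the inversion set of the form
`{α, β, α + β}`. -/
def IsInversionTriple (w : W) (T : Set (B →₀ ℝ)) : Prop :=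
  T ⊆ cs.inversionSet w ∧ ∃ α β : B →₀ ℝ, T = {α, β, α + β}

/-- The set of contractible inversion triples of `w`: those whose three elements appear
consecutively, in some order, in some root sequence for `w`. -/
def contractibleTriples (w : W) : Set (Set (B →₀ ℝ)) :=
  {T | cs.IsInversionTriple w T ∧
    ∃ (r₁ r₂ : List (B →₀ ℝ)) (a b c : B →₀ ℝ),
      cs.IsRootSeq w (r₁ ++ [a, b, c] ++ r₂) ∧ T = {a, b, c}}

/-- `w` is freely braided: its contractible inversion triples are pairwise disjoint. -/
def IsFreelyBraided (w : W) : Prop := (cs.contractibleTriples w).PairwiseDisjoint id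

/-- The support of `w`: the set of letters that appear in some reduced expression for `w`. -/
def support (w : W) : Set B :=
  {i | ∃ ω : List B, cs.IsReduced ω ∧ cs.wordProd ω = w ∧ i ∈ ω}

/-- `w` is content maximal: it is freely braided and `# supp w = ℓ w - N w`, where `N w` is the
number of contractible inversion triples of `w`. -/
def IsContentMaximal (w : W) : Prop :=
  cs.IsFreelyBraided w ∧
    ((cs.support w).ncard : ℤ) = (cs.length w : ℤ) - ((cs.contractibleTriples w).ncard : ℤ)

end Roots

end CoxeterSystem

namespace CoxeterMatrix

/-- The Coxeter matrix of type `D n`, for `n ≥ 4`: the nodes `0` and `1` are both joined to `2`,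
and `2, 3, …, n - 1` form a path. (The matrix `CoxeterMatrix.D` of Mathlib joins, in addition, the
two end nodes of the fork, so it is not used here.) -/
def typeD (n : ℕ) : CoxeterMatrix (Fin n) where
  M := Matrix.of fun i j : Fin n ↦
    if i = j then 1
    else if ((i : ℕ) = 0 ∧ (j : ℕ) = 2) ∨ ((j : ℕ) = 0 ∧ (i : ℕ) = 2) ∨
      (1 ≤ (i : ℕ) ∧ (i : ℕ) + 1 = j) ∨ (1 ≤ (j : ℕ) ∧ (j : ℕ) + 1 = i) then 3
    else 2
  isSymm := by
    ext i j
    simp only [Matrix.transpose_apply, Matrix.of_apply]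
    grind
  diagonal := by simp
  off_diagonal := by
    intro i j h
    simp only [Matrix.of_apply]
    grind

/-- The Coxeter matrix of type `E n`, for `n ≥ 6`: the node `3` is joined to the three nodes
`1`, `2`, `4`; the node `2` is joined to `0`; and `4, 5, …, n - 1` form a path. Thus the three arms
at the branch node have `1`, `2` and `n - 4` nodes. -/
def typeE (n : ℕ) : CoxeterMatrix (Fin n) where
  M := Matrix.of fun i j : Fin n ↦
    if i = j then 1
    else if ((i : ℕ) = 0 ∧ (j : ℕ) = 2) ∨ ((j : ℕ) = 0 ∧ (i : ℕ) = 2) ∨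
      ((i : ℕ) = 1 ∧ (j : ℕ) = 3) ∨ ((j : ℕ) = 1 ∧ (i : ℕ) = 3) ∨
      (2 ≤ (i : ℕ) ∧ (i : ℕ) + 1 = j) ∨ (2 ≤ (j : ℕ) ∧ (j : ℕ) + 1 = i) then 3
    else 2
  isSymm := by
    ext i j
    simp only [Matrix.transpose_apply, Matrix.of_apply]
    grind
  diagonal := by simp
  off_diagonal := by
    intro i j h
    simp only [Matrix.of_apply]
    grind

/-- The set of content maximal elements of the Coxeter group with Coxeter matrix `M`. -/
def contentMaximalSet {B : Type*} (M : CoxeterMatrix B) : Set M.Group :=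
  {w | M.toCoxeterSystem.IsContentMaximal w}

/-- The number of content maximal elements (meaningful when there are finitely many). -/
def numContentMaximal {B : Type*} (M : CoxeterMatrix B) : ℕ := M.contentMaximalSet.ncard

end CoxeterMatrix

/-- The ordinary generating function `∑_{n ≥ n₀} a n * X ^ n`. -/
def ogfFrom (n₀ : ℕ) (a : ℕ → ℕ) : ℚ⟦X⟧ :=
  PowerSeries.mk fun n => if n₀ ≤ n then (a n : ℚ) else 0

end

/-! The theorem reduces to counting words. Say that two adjacent vertices of the Coxeter graph cross
in a word if each has an occurrence before an occurrence of the other. A word is `Matched` if its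
crossing pairs form a matching of the graph, the two letters of such a pair occur three times in
all, and no other letter is repeated. The content maximal elements are exactly the products of
matched words (`isContentMaximal_iff_exists_matched`).

For one direction, braid moves preserve being matched and preserve the crossing pairs, and a matched
word never contains `s s`. Hence matched words are reduced by Tits' theorem, and two of them with
the same product are braid equivalent by Matsumoto's theorem. The contractible triples of the
product correspond to the crossing pairs (`contractible_iff_of_matched`). Triples of disjoint pairs
are disjoint, and each pair accounts for exactly one repeated letter, so `ℓ = # supp + N`.

Conversely, for a freely braided element the quantity `ℓ - # supp - N` is nonnegative and does not
increase when a descent is removed (`excess_mul_simple_le`). So if it vanishes for `w`, it vanishes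
for every right truncation, and induction applies: the last letter is either new or completes a
braid `s v s` on two letters that were not crossing anything (`not_cross_of_contractible`,
`Matched.append_braid`).

To count, attach a leaf `i` to a vertex `j`. Every matched element over the larger graph is exactly
one of `w`, `sᵢ w`, `w sᵢ` with `j` in `w`, or `sᵢ w sᵢ` with `j` occurring in `w` without crossing
anything, where `w` is a matched element over the smaller graph (`encard_matchedElements_insert`).
It therefore suffices to follow three states of one vertex: absent, single, crossed. Extending a
path by one vertex acts on the three counts by a fixed matrix with characteristic polynomial `x³ -
3x² - x + 1`, which gives the common denominator. The branches in types `D` and `E` only change the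
linear form applied to the path counts. Finiteness of the group plays no role. -/

noncomputable section

/-- A Coxeter matrix is simply laced if all its off-diagonal entries are `2` or `3`. -/
def CoxeterMatrix.IsSimplyLaced {B : Type*} (M : CoxeterMatrix B) : Prop :=
  ∀ i j, i ≠ j → M i j = 2 ∨ M i j = 3

/-! ### Descents as signs of roots -/

namespace CoxeterSystem

section RootSigns

variable {B : Type*} {W : Type*} [Group W] {M : CoxeterMatrix B} (cs : CoxeterSystem M W)

theorem simpleReflection_simpleRoot_self (i : B) :
    simpleReflection M i (simpleRoot i) = -simpleRoot i := by
  rw [simpleReflection_apply, coxeterForm_simpleRoot, M.diagonal]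
  simp [two_smul]

theorem simpleReflection_simpleRoot_of_two {i j : B} (h : M i j = 2) :
    simpleReflection M i (simpleRoot j) = simpleRoot j := by
  rw [simpleReflection_apply, coxeterForm_simpleRoot, M.symmetric, h]
  simp

theorem simpleReflection_simpleRoot_of_three {i j : B} (h : M i j = 3) :
    simpleReflection M i (simpleRoot j) = simpleRoot j + simpleRoot i := by
  rw [simpleReflection_apply, coxeterForm_simpleRoot, M.symmetric, h]
  simp

theorem reflectionRep_mul_apply (w v : W) (x : B →₀ ℝ) :
    cs.reflectionRep (w * v) x = cs.reflectionRep w (cs.reflectionRep v x) := by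
  rw [map_mul, Module.End.mul_apply]

theorem reflectionRep_inv_apply_self (w : W) (x : B →₀ ℝ) :
    cs.reflectionRep w⁻¹ (cs.reflectionRep w x) = x := by
  rw [← reflectionRep_mul_apply]; simp

theorem reflectionRep_injective (w : W) : Function.Injective (cs.reflectionRep w) :=
  Function.LeftInverse.injective (cs.reflectionRep_inv_apply_self w)

theorem reflectionRep_mul_simple_self (w : W) (i : B) :
    cs.reflectionRep (w * cs.simple i) (simpleRoot i) = -cs.reflectionRep w (simpleRoot i) := by
  rw [reflectionRep_mul_apply, reflectionRep_simple, simpleReflection_simpleRoot_self, map_neg]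

theorem reflectionRep_mul_simple_of_two (w : W) {i j : B} (h : M i j = 2) :
    cs.reflectionRep (w * cs.simple i) (simpleRoot j) = cs.reflectionRep w (simpleRoot j) := by
  rw [reflectionRep_mul_apply, reflectionRep_simple, simpleReflection_simpleRoot_of_two h]

theorem reflectionRep_mul_simple_of_three (w : W) {i j : B} (h : M i j = 3) :
    cs.reflectionRep (w * cs.simple i) (simpleRoot j) =
      cs.reflectionRep w (simpleRoot j) + cs.reflectionRep w (simpleRoot i) := by
  rw [reflectionRep_mul_apply, reflectionRep_simple, simpleReflection_simpleRoot_of_three h,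
    map_add]

theorem simpleRoot_ne_zero (i : B) : (simpleRoot i : B →₀ ℝ) ≠ 0 := by
  simp [simpleRoot]

theorem simpleRoot_nonneg (i : B) : (0 : B →₀ ℝ) ≤ simpleRoot i :=
  Finsupp.single_nonneg.2 zero_le_one

theorem simpleRoot_injective : Function.Injective (simpleRoot : B → B →₀ ℝ) :=
  fun _ _ h => Finsupp.single_left_injective one_ne_zero h

theorem reflectionRep_simpleRoot_ne_zero (w : W) (i : B) :
    cs.reflectionRep w (simpleRoot i) ≠ 0 := by
  rw [Ne, map_eq_zero_iff _ (cs.reflectionRep_injective w)]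
  exact simpleRoot_ne_zero i

theorem simple_mul_comm {i j : B} (h : M i j = 2) :
    cs.simple i * cs.simple j = cs.simple j * cs.simple i := by
  have := cs.simple_mul_simple_pow i j
  rw [h, pow_two] at this
  have h2 := mul_eq_one_iff_eq_inv.1 this
  simpa using h2

theorem simple_braid {i j : B} (h : M i j = 3) :
    cs.simple i * cs.simple j * cs.simple i = cs.simple j * cs.simple i * cs.simple j := by
  have := cs.simple_mul_simple_pow i j
  rw [h, pow_succ, pow_two] at this
  have h2 : cs.simple i * cs.simple j * cs.simple i * (cs.simple j * cs.simple i * cs.simple j)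
      = 1 := by simpa [mul_assoc] using this
  have h3 := mul_eq_one_iff_eq_inv.1 h2
  simpa [mul_assoc] using h3

/-- An element with `ℓ (w s) > ℓ w` sends the simple root of `s` to a nonnegative vector. -/
theorem reflectionRep_simpleRoot_nonneg (hM : M.IsSimplyLaced) {w : W} {s : B}
    (h : ¬cs.IsRightDescent w s) : 0 ≤ cs.reflectionRep w (simpleRoot s) := by
  induction hn : cs.length w using Nat.strong_induction_on generalizing w s with
  | _ n ih =>
  subst hn
  by_cases hw : w = 1
  · subst hw
    simpa using simpleRoot_nonneg s
  obtain ⟨t, ht⟩ := cs.exists_rightDescent_of_ne_one hw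
  have hst : t ≠ s := by
    rintro rfl
    exact h ht
  have hs := cs.not_isRightDescent_iff.1 h
  have ht' := cs.isRightDescent_iff.1 ht
  have hwt : w = w * cs.simple t * cs.simple t := by simp
  rcases hM t s hst with h2 | h3
  · rw [hwt, reflectionRep_mul_simple_of_two _ _ h2]
    refine ih _ ht (fun hd => ?_) rfl
    rw [IsRightDescent, mul_assoc, cs.simple_mul_comm h2, ← mul_assoc] at hd
    have := cs.length_mul_simple (w * cs.simple s) t
    omega
  · have hvt : ¬cs.IsRightDescent (w * cs.simple t) t := by
      rw [IsRightDescent, ← hwt]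
      omega
    by_cases hvs : cs.IsRightDescent (w * cs.simple t) s
    · have hvs' := cs.isRightDescent_iff.1 hvs
      -- If `s` is a descent of `v = w t`, then `v (α_s + α_t) = (v s) α_t`, and `v s` is shorter
      -- still.
      have h5 : cs.reflectionRep w (simpleRoot s) =
          cs.reflectionRep (w * cs.simple t * cs.simple s) (simpleRoot t) := by
        conv_lhs => rw [hwt]
        have h3' : M s t = 3 := by rw [M.symmetric, h3]
        rw [reflectionRep_mul_simple_of_three _ _ h3, reflectionRep_mul_simple_of_three _ _ h3',
          add_comm]
      rw [h5]
      refine ih _ (by omega) (fun hd => ?_) rfl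
      -- If `t` were a descent of `w t s`, then `w t s t` would have length `ℓ w - 3`, and `w s = (w
      -- t s t) s t` would have length at most `ℓ w - 1`, against the assumption on `s`.
      have h6 : w * cs.simple s = w * cs.simple t * cs.simple s * cs.simple t * cs.simple s *
          cs.simple t := by
        have h8 : w * cs.simple t * cs.simple s * cs.simple t * cs.simple s * cs.simple t =
          w * cs.simple t * cs.simple s * (cs.simple t * cs.simple s * cs.simple t) := by
          simp only [mul_assoc]
        rw [h8, cs.simple_braid h3]
        simp [mul_assoc]
      have h7 := cs.isRightDescent_iff.1 hd
      have h9 := cs.length_mul_simple (w * cs.simple t * cs.simple s * cs.simple t) s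
      have h10 := cs.length_mul_simple
        (w * cs.simple t * cs.simple s * cs.simple t * cs.simple s) t
      rw [← h6] at h10
      omega
    · rw [hwt, reflectionRep_mul_simple_of_three _ _ h3]
      exact add_nonneg (ih _ ht hvs rfl) (ih _ ht hvt rfl)

theorem reflectionRep_simpleRoot_nonpos (hM : M.IsSimplyLaced) {w : W} {s : B}
    (h : cs.IsRightDescent w s) : cs.reflectionRep w (simpleRoot s) ≤ 0 := by
  have h1 : ¬cs.IsRightDescent (w * cs.simple s) s := cs.isRightDescent_iff_not_isRightDescent_mul.1 h
  have h2 := cs.reflectionRep_simpleRoot_nonneg hM h1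
  rw [reflectionRep_mul_simple_self] at h2
  exact neg_nonneg.1 h2

/-- A root `w α_s` is nonzero, so its sign decides. Questions about descents thus become linear
algebra in the plane spanned by two simple roots, which takes the place of the exchange condition
below. -/
theorem isRightDescent_iff_nonpos (hM : M.IsSimplyLaced) {w : W} {s : B} :
    cs.IsRightDescent w s ↔ cs.reflectionRep w (simpleRoot s) ≤ 0 := by
  refine ⟨cs.reflectionRep_simpleRoot_nonpos hM, fun h => ?_⟩
  by_contra h1
  exact cs.reflectionRep_simpleRoot_ne_zero w s
    (le_antisymm h (cs.reflectionRep_simpleRoot_nonneg hM h1))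

theorem isRightDescent_mul_simple_of_two (hM : M.IsSimplyLaced) {w : W} {s t : B}
    (h : M s t = 2) : cs.IsRightDescent (w * cs.simple s) t ↔ cs.IsRightDescent w t := by
  rw [cs.isRightDescent_iff_nonpos hM, cs.isRightDescent_iff_nonpos hM,
    reflectionRep_mul_simple_of_two _ _ h]

theorem isRightDescent_mul_simple_of_three (hM : M.IsSimplyLaced) {w : W} {s t : B}
    (h : M s t = 3) (hs : cs.IsRightDescent w s) (ht : cs.IsRightDescent w t) :
    cs.IsRightDescent (w * cs.simple s) t := by
  rw [cs.isRightDescent_iff_nonpos hM] at *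
  rw [reflectionRep_mul_simple_of_three _ _ h]
  exact add_nonpos ht hs

/-- Because `s t` maps `α_s` to `α_t` when `m = 3`. -/
theorem isRightDescent_mul_simple_mul_simple_of_three (hM : M.IsSimplyLaced) {w : W} {s t : B}
    (h : M s t = 3) :
    cs.IsRightDescent (w * cs.simple s * cs.simple t) s ↔ cs.IsRightDescent w t := by
  rw [cs.isRightDescent_iff_nonpos hM, cs.isRightDescent_iff_nonpos hM,
    reflectionRep_mul_simple_of_three _ _ (by rw [M.symmetric, h]), reflectionRep_mul_simple_self,
    reflectionRep_mul_simple_of_three _ _ h]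
  simp

end RootSigns

end CoxeterSystem

/-! ### Braid moves on words -/

/-- An elementary braid move between words in a simply laced Coxeter group. -/
inductive CoxeterMatrix.BraidStep {B : Type*} (M : CoxeterMatrix B) : List B → List B → Prop
  | swap (u v : List B) {s t : B} (h : M s t = 2) : BraidStep M (u ++ s :: t :: v) (u ++ t :: s :: v)
  | braid (u v : List B) {s t : B} (h : M s t = 3) :
      BraidStep M (u ++ s :: t :: s :: v) (u ++ t :: s :: t :: v)

/-- Two words are braid equivalent if they are connected by a sequence of braid moves. -/
def CoxeterMatrix.BraidEquiv {B : Type*} (M : CoxeterMatrix B) : List B → List B → Prop :=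
  Relation.ReflTransGen M.BraidStep

namespace CoxeterMatrix

variable {B : Type*} {M : CoxeterMatrix B}

theorem BraidStep.symm {a b : List B} (h : M.BraidStep a b) : M.BraidStep b a := by
  cases h with
  | swap u v h => exact .swap u v (by rw [M.symmetric, h])
  | braid u v h => exact .braid u v (by rw [M.symmetric, h])

theorem BraidStep.append {a b : List B} (h : M.BraidStep a b) (c d : List B) :
    M.BraidStep (c ++ a ++ d) (c ++ b ++ d) := by
  cases h with
  | swap u v h => simpa using BraidStep.swap (c ++ u) (v ++ d) h
  | braid u v h => simpa using BraidStep.braid (c ++ u) (v ++ d) h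

theorem BraidEquiv.refl (a : List B) : M.BraidEquiv a a := Relation.ReflTransGen.refl

theorem BraidEquiv.trans {a b c : List B} (h : M.BraidEquiv a b) (h' : M.BraidEquiv b c) :
    M.BraidEquiv a c := Relation.ReflTransGen.trans h h'

theorem BraidEquiv.symm {a b : List B} (h : M.BraidEquiv a b) : M.BraidEquiv b a := by
  have : Std.Symm M.BraidStep := ⟨fun _ _ h => h.symm⟩
  exact Relation.ReflTransGen.stdSymm.symm _ _ h

theorem BraidEquiv.append {a b : List B} (h : M.BraidEquiv a b) (c d : List B) :
    M.BraidEquiv (c ++ a ++ d) (c ++ b ++ d) :=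
  h.lift (fun x => c ++ x ++ d) fun _ _ h => BraidStep.append h c d

theorem BraidStep.length_eq {a b : List B} (h : M.BraidStep a b) : a.length = b.length := by
  cases h <;> simp

theorem BraidEquiv.length_eq {a b : List B} (h : M.BraidEquiv a b) : a.length = b.length := by
  induction h with
  | refl => rfl
  | tail _ h ih => exact ih.trans h.length_eq

theorem BraidStep.mem_iff {a b : List B} (h : M.BraidStep a b) (x : B) : x ∈ a ↔ x ∈ b := by
  cases h <;> simp only [List.mem_append, List.mem_cons] <;> tauto

theorem BraidEquiv.mem_iff {a b : List B} (h : M.BraidEquiv a b) (x : B) : x ∈ a ↔ x ∈ b := by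
  induction h with
  | refl => rfl
  | tail _ h ih => exact ih.trans (h.mem_iff x)

/-- A letter commutes past a word all of whose letters commute with it. -/
theorem braidEquiv_cons_concat {s : B} {b : List B} (h : ∀ x ∈ b, M s x = 2) :
    M.BraidEquiv (s :: b) (b ++ [s]) := by
  induction b with
  | nil => exact .refl _
  | cons x b ih =>
    have h1 : M.BraidEquiv (s :: x :: b) (x :: s :: b) :=
      .single (.swap [] b (h x (by simp)))
    exact h1.trans (by simpa using (ih fun y hy => h y (by simp [hy])).append [x] [])

end CoxeterMatrix

/-! ### The theorems of Matsumoto and Tits -/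

namespace CoxeterSystem

open CoxeterMatrix

section Matsumoto

variable {B : Type*} {W : Type*} [Group W] {M : CoxeterMatrix B} (cs : CoxeterSystem M W)

theorem wordProd_eq_of_braidStep {a b : List B} (h : M.BraidStep a b) :
    cs.wordProd a = cs.wordProd b := by
  cases h with
  | swap u v h =>
    simp only [wordProd_append, wordProd_cons]
    rw [← mul_assoc (cs.simple _) (cs.simple _), cs.simple_mul_comm h, mul_assoc]
  | @braid u v s t h =>
    have h1 := cs.simple_braid h
    have h2 : ∀ x y z : W, x * (y * (x * z)) = x * y * x * z := fun x y z => by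
      simp only [mul_assoc]
    simp only [wordProd_append, wordProd_cons]
    rw [h2, h1, h2]

theorem wordProd_eq_of_braidEquiv {a b : List B} (h : M.BraidEquiv a b) :
    cs.wordProd a = cs.wordProd b := by
  induction h with
  | refl => rfl
  | tail _ h ih => exact ih.trans (cs.wordProd_eq_of_braidStep h)

theorem isReduced_of_braidEquiv {a b : List B} (h : M.BraidEquiv a b) (ha : cs.IsReduced a) :
    cs.IsReduced b := by
  rw [IsReduced] at *
  rw [← cs.wordProd_eq_of_braidEquiv h, ha, h.length_eq]

theorem isReduced_nil : cs.IsReduced [] := by simp [IsReduced]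

theorem wordProd_append_singleton (ω : List B) (s : B) :
    cs.wordProd (ω ++ [s]) = cs.wordProd ω * cs.simple s := by
  simp [wordProd_append]

theorem isReduced_of_append_left {u v : List B} (h : cs.IsReduced (u ++ v)) : cs.IsReduced u := by
  simpa using h.take u.length

theorem isReduced_of_append_right {u v : List B} (h : cs.IsReduced (u ++ v)) : cs.IsReduced v := by
  simpa using h.drop u.length

theorem isReduced_append_singleton {ω : List B} {s : B} :
    cs.IsReduced (ω ++ [s]) ↔ cs.IsReduced ω ∧ ¬cs.IsRightDescent (cs.wordProd ω) s := by
  constructor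
  · intro h
    have h1 := cs.isReduced_of_append_left h
    refine ⟨h1, ?_⟩
    rw [IsReduced] at h h1
    rw [not_isRightDescent_iff, ← wordProd_append_singleton, h, h1]
    simp
  · rintro ⟨h1, h2⟩
    rw [IsReduced] at *
    rw [wordProd_append_singleton, cs.not_isRightDescent_iff.1 h2, h1]
    simp

theorem isRightDescent_of_isReduced_append_singleton {ω : List B} {s : B}
    (h : cs.IsReduced (ω ++ [s])) : cs.IsRightDescent (cs.wordProd (ω ++ [s])) s := by
  have := (cs.isReduced_append_singleton.1 h).2
  rw [cs.isRightDescent_iff_not_isRightDescent_mul, wordProd_append_singleton]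
  simpa using this

theorem isReduced_append_singleton_of_isRightDescent {ω : List B} {w : W} {s : B}
    (hs : cs.IsRightDescent w s) (hω : cs.IsReduced ω) (h : cs.wordProd ω = w * cs.simple s) :
    cs.IsReduced (ω ++ [s]) ∧ cs.wordProd (ω ++ [s]) = w := by
  refine ⟨cs.isReduced_append_singleton.2 ⟨hω, ?_⟩, ?_⟩
  · rw [h]
    exact cs.isRightDescent_iff_not_isRightDescent_mul.1 hs
  · rw [wordProd_append_singleton, h]
    simp

theorem exists_isReduced_append_singleton {w : W} {s : B} (hs : cs.IsRightDescent w s) :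
    ∃ ω, cs.IsReduced (ω ++ [s]) ∧ cs.wordProd (ω ++ [s]) = w := by
  obtain ⟨ω, hω, h⟩ := cs.exists_isReduced (w * cs.simple s)
  exact ⟨ω, cs.isReduced_append_singleton_of_isRightDescent hs hω h.symm⟩

/-- The sign criterion shows that `t` is a descent of `w s` and `s` one of `w s t`, so three letters
can be peeled off in turn. -/
theorem exists_isReduced_append_braid (hM : M.IsSimplyLaced) {w : W} {s t : B} (h : M s t = 3)
    (hs : cs.IsRightDescent w s) (ht : cs.IsRightDescent w t) :
    ∃ ω, cs.IsReduced (ω ++ [s, t, s]) ∧ cs.wordProd (ω ++ [s, t, s]) = w := by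
  have h1 := cs.isRightDescent_mul_simple_of_three hM h hs ht
  have h2 := (cs.isRightDescent_mul_simple_mul_simple_of_three hM h).2 ht
  obtain ⟨ω, hω, hw⟩ := cs.exists_isReduced_append_singleton h2
  have h3 := cs.isReduced_append_singleton_of_isRightDescent h1 hω hw
  have h4 := cs.isReduced_append_singleton_of_isRightDescent hs h3.1 h3.2
  exact ⟨ω, by simpa using h4⟩

/-- Matsumoto's theorem in the simply laced case. -/
theorem braidEquiv_of_wordProd_eq (hM : M.IsSimplyLaced) {a b : List B} (ha : cs.IsReduced a)
    (hb : cs.IsReduced b) (h : cs.wordProd a = cs.wordProd b) : M.BraidEquiv a b := by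
  induction hn : a.length using Nat.strong_induction_on generalizing a b with
  | _ n ih =>
  subst hn
  have hlen : a.length = b.length := by
    rw [IsReduced] at ha hb
    rw [← ha, ← hb, h]
  rcases List.eq_nil_or_concat' a with rfl | ⟨a, s, rfl⟩
  · rw [List.length_nil, eq_comm, List.length_eq_zero_iff] at hlen
    exact hlen ▸ .refl _
  rcases List.eq_nil_or_concat' b with rfl | ⟨b, t, rfl⟩
  · simp at hlen
  have hs := cs.isRightDescent_of_isReduced_append_singleton ha
  have ht := cs.isRightDescent_of_isReduced_append_singleton hb
  rw [← h] at ht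
  set w := cs.wordProd (a ++ [s]) with hw
  have hwa : cs.wordProd a = w * cs.simple s := by rw [hw, wordProd_append_singleton]; simp
  have hwb : cs.wordProd b = w * cs.simple t := by rw [h, wordProd_append_singleton]; simp
  have ha' := cs.isReduced_of_append_left ha
  have hb' := cs.isReduced_of_append_left hb
  have hal : a.length < (a ++ [s]).length := by simp
  have hbl : b.length < (a ++ [s]).length := by rw [hlen]; simp
  -- The last letters `s` and `t` are both descents of `w`, so `w` has a reduced word ending in `t
  -- s` or in `s t s`, according to `M s t`. Induction on the words without their last letter
  -- connects `a` to this word and `b` to its image under one move.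
  rcases eq_or_ne s t with rfl | hst
  · simpa using (ih _ hal ha' hb' (hwa.trans hwb.symm) rfl).append [] [s]
  rcases hM s t hst with h2 | h3
  · have ht1 := (cs.isRightDescent_mul_simple_of_two hM h2).2 ht
    have hs1 := (cs.isRightDescent_mul_simple_of_two hM (M.symmetric s t ▸ h2)).2 hs
    obtain ⟨c, hc, hcw⟩ := cs.exists_isReduced (w * cs.simple s * cs.simple t)
    have h4 := cs.isReduced_append_singleton_of_isRightDescent ht1 hc hcw.symm
    have h5 := cs.isReduced_append_singleton_of_isRightDescent (ω := c) hs1 hc (by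
      rw [← hcw, mul_assoc, cs.simple_mul_comm h2, mul_assoc])
    have e1 := ih _ hal ha' h4.1 (hwa.trans h4.2.symm) rfl
    have e2 := ih _ hbl hb' h5.1 (hwb.trans h5.2.symm) rfl
    have e3 : M.BraidEquiv (c ++ [t] ++ [s]) (c ++ [s] ++ [t]) := by
      simpa [BraidEquiv] using
        Relation.ReflTransGen.single (BraidStep.swap c [] (M.symmetric s t ▸ h2))
    exact ((e1.append [] [s]).trans e3).trans (e2.append [] [t]).symm
  · have h3' : M t s = 3 := by rw [M.symmetric, h3]
    obtain ⟨c, hc, hcw⟩ := cs.exists_isReduced_append_braid hM h3 hs ht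
    have e0 : M.BraidEquiv (c ++ [s, t, s]) (c ++ [t, s, t]) :=
      .single (BraidStep.braid c [] h3)
    have hc' := cs.isReduced_of_braidEquiv e0 hc
    have hcw' := (cs.wordProd_eq_of_braidEquiv e0).symm.trans hcw
    have q1 : c ++ [s, t, s] = (c ++ [s, t]) ++ [s] := by simp
    have q2 : c ++ [t, s, t] = (c ++ [t, s]) ++ [t] := by simp
    rw [q1] at hc hcw e0
    rw [q2] at hc' hcw' e0
    have e1 := ih _ hal ha' (cs.isReduced_of_append_left hc) (by
      rw [hwa, ← hcw, wordProd_append_singleton]; simp) rfl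
    have e2 := ih _ hbl hb' (cs.isReduced_of_append_left hc') (by
      rw [hwb, ← hcw', wordProd_append_singleton]; simp) rfl
    exact ((e1.append [] [s]).trans e0).trans (e2.append [] [t]).symm

/-- Tits' theorem: a word that is not reduced is braid equivalent to one with a repeated letter. -/
theorem exists_braidEquiv_of_not_isReduced (hM : M.IsSimplyLaced) {a : List B}
    (ha : ¬cs.IsReduced a) : ∃ u s v, M.BraidEquiv a (u ++ s :: s :: v) := by
  induction a using List.reverseRecOn with
  | nil => exact (ha cs.isReduced_nil).elim
  | append_singleton a s ih =>
    by_cases h : cs.IsReduced a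
    · have hs : cs.IsRightDescent (cs.wordProd a) s := by
        by_contra hs
        exact ha (cs.isReduced_append_singleton.2 ⟨h, hs⟩)
      obtain ⟨c, hc, hcw⟩ := cs.exists_isReduced_append_singleton hs
      refine ⟨c, s, [], ?_⟩
      simpa using (cs.braidEquiv_of_wordProd_eq hM h hc hcw.symm).append [] [s]
    · obtain ⟨u, t, v, e⟩ := ih h
      exact ⟨u, t, v ++ [s], by simpa using e.append [] [s]⟩

theorem support_eq (hM : M.IsSimplyLaced) {a : List B} (ha : cs.IsReduced a) :
    cs.support (cs.wordProd a) = {i | i ∈ a} := by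
  ext i
  constructor
  · rintro ⟨b, hb, h, hi⟩
    exact ((cs.braidEquiv_of_wordProd_eq hM hb ha h).mem_iff i).1 hi
  · exact fun hi => ⟨a, ha, rfl, hi⟩

end Matsumoto

end CoxeterSystem

/-! ### Matched words and their crossing pairs -/

namespace CoxeterMatrix

section Words

variable {B : Type*} {M : CoxeterMatrix B}

/-- Some occurrence of `s` precedes some occurrence of `t` in the word `a`. -/
def Precedes (a : List B) (s t : B) : Prop := [s, t].Sublist a

/-- The letters `s` and `t` cross in the word `a`: each has an occurrence before one of the
other. -/
def Cross (a : List B) (s t : B) : Prop := Precedes a s t ∧ Precedes a t s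

theorem not_precedes_nil (s t : B) : ¬Precedes [] s t := by simp [Precedes]

theorem precedes_cons {x : B} {a : List B} {s t : B} :
    Precedes (x :: a) s t ↔ (s = x ∧ t ∈ a) ∨ Precedes a s t := by
  rw [Precedes, Precedes, List.cons_sublist_cons']
  simp
  tauto

theorem precedes_append {a b : List B} {s t : B} :
    Precedes (a ++ b) s t ↔ Precedes a s t ∨ (s ∈ a ∧ t ∈ b) ∨ Precedes b s t := by
  induction a with
  | nil => simp [not_precedes_nil]
  | cons x a ih => grind [precedes_cons]

theorem Precedes.mem_left {a : List B} {s t : B} (h : Precedes a s t) : s ∈ a := h.subset (by simp)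

theorem Precedes.mem_right {a : List B} {s t : B} (h : Precedes a s t) : t ∈ a := h.subset (by simp)

theorem Cross.symm {a : List B} {s t : B} (h : Cross a s t) : Cross a t s := ⟨h.2, h.1⟩

theorem ne_of_three {s t : B} (h : M s t = 3) : s ≠ t := by
  rintro rfl
  simp at h

variable [DecidableEq B]

/-- A word is matched if no letter crosses two neighbours, every two neighbouring letters that
cross form, up to commutations, a single braid, and no other letter is repeated. -/
structure Matched (M : CoxeterMatrix B) (a : List B) : Prop where
  count_add_count : ∀ {s t}, M s t = 3 → Cross a s t → a.count s + a.count t = 3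
  unique : ∀ {s t t'}, M s t = 3 → M s t' = 3 → Cross a s t → Cross a s t' → t = t'
  exists_cross : ∀ {s}, 2 ≤ a.count s → ∃ t, M s t = 3 ∧ Cross a s t

theorem matched_nil : M.Matched [] :=
  ⟨fun _ h => (not_precedes_nil _ _ h.1).elim, fun _ _ h => (not_precedes_nil _ _ h.1).elim,
    by simp⟩

theorem Matched.notMem_of_braid {u v : List B} {s t : B} (h : M.Matched (u ++ s :: t :: s :: v))
    (hst : M s t = 3) : s ∉ u ∧ s ∉ v ∧ t ∉ u ∧ t ∉ v := by
  have h1 := h.count_add_count hst ⟨by simp [precedes_append, precedes_cons],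
    by simp [precedes_append, precedes_cons]⟩
  have hne := ne_of_three hst
  simp [hne, hne.symm] at h1
  simp only [← List.count_eq_zero]
  omega

/-- A swap exchanges only non-neighbours. A braid block `p q p` or `q p q` contains both orders of
`p` and `q`, and towards any other letter only the set of letters of the block matters. -/
theorem Matched.precedes_iff_of_braidStep {a b : List B} (ha : M.Matched a)
    (h : M.BraidStep a b) {s t : B} (hst : M s t = 3) : Precedes a s t ↔ Precedes b s t := by
  have hne := ne_of_three hst
  cases h with
  | @swap u v p q h =>
    have h1 : ¬(s = p ∧ t = q) := by
      rintro ⟨rfl, rfl⟩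
      omega
    have h2 : ¬(s = q ∧ t = p) := by
      rintro ⟨rfl, rfl⟩
      rw [M.symmetric] at hst
      omega
    simp only [precedes_append, precedes_cons, List.mem_cons]
    tauto
  | @braid u v p q h =>
    obtain ⟨h1, h2, h3, h4⟩ := ha.notMem_of_braid h
    simp only [precedes_append, precedes_cons, List.mem_cons]
    grind

theorem Matched.cross_iff_of_braidStep {a b : List B} (ha : M.Matched a)
    (h : M.BraidStep a b) {s t : B} (hst : M s t = 3) : Cross a s t ↔ Cross b s t :=
  and_congr (ha.precedes_iff_of_braidStep h hst)
    (ha.precedes_iff_of_braidStep h (by rw [M.symmetric, hst]))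

/-- Crossing pairs are the same on both sides, so only the counts have to be followed. A braid on
`p, q` changes the two counts but not their sum, and since `p` and `q` cross each other, uniqueness
keeps both letters out of every other crossing pair. -/
theorem Matched.of_braidStep {a b : List B} (ha : M.Matched a) (h : M.BraidStep a b) :
    M.Matched b := by
  have hc := fun {s t} hst => ha.cross_iff_of_braidStep h (s := s) (t := t) hst
  refine ⟨fun {s t} hst hcr => ?_, fun h1 h2 h3 h4 => ha.unique h1 h2 ((hc h1).2 h3) ((hc h2).2 h4),
    fun {s} hs => ?_⟩
  · have hcr' := (hc hst).2 hcr
    have h1 := ha.count_add_count hst hcr'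
    cases h with
    | @swap u v p q h =>
      have hp : (u ++ p :: q :: v).Perm (u ++ q :: p :: v) := (List.Perm.swap q p v).append_left u
      rwa [← hp.count_eq, ← hp.count_eq]
    | @braid u v p q h =>
      have hpq : Cross (u ++ p :: q :: p :: v) p q := by
        simp [Cross, precedes_append, precedes_cons]
      have h' : M q p = 3 := by rw [M.symmetric, h]
      have e1 : s = p → t = q := fun hs => by
        subst hs
        exact ha.unique hst h hcr' hpq
      have e2 : s = q → t = p := fun hs => by
        subst hs
        exact ha.unique hst h' hcr' hpq.symm
      have hst' : M t s = 3 := by rw [M.symmetric, hst]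
      have e3 : t = p → s = q := fun hs => by
        subst hs
        exact ha.unique hst' h hcr'.symm hpq
      have e4 : t = q → s = p := fun hs => by
        subst hs
        exact ha.unique hst' h' hcr'.symm hpq.symm
      have hne := ne_of_three h
      simp only [List.count_append, List.count_cons, beq_iff_eq] at h1 ⊢
      grind
  · suffices ∃ t, M s t = 3 ∧ Cross a s t by
      obtain ⟨t, h1, h2⟩ := this
      exact ⟨t, h1, (hc h1).1 h2⟩
    cases h with
    | @swap u v p q h =>
      have hp : (u ++ p :: q :: v).Perm (u ++ q :: p :: v) := (List.Perm.swap q p v).append_left u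
      exact ha.exists_cross (by rwa [hp.count_eq])
    | @braid u v p q h =>
      have hpq : Cross (u ++ p :: q :: p :: v) p q := by
        simp [Cross, precedes_append, precedes_cons]
      by_cases hp : s = p
      · exact ⟨q, by rw [hp, h], by rw [hp]; exact hpq⟩
      by_cases hq : s = q
      · exact ⟨p, by rw [hq, M.symmetric, h], by rw [hq]; exact hpq.symm⟩
      refine ha.exists_cross ?_
      simp only [List.count_append, List.count_cons, beq_iff_eq] at hs ⊢
      grind

theorem Matched.of_braidEquiv {a b : List B} (ha : M.Matched a) (h : M.BraidEquiv a b) :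
    M.Matched b := by
  induction h with
  | refl => exact ha
  | tail _ h ih => exact ih.of_braidStep h

theorem Matched.precedes_iff_of_braidEquiv {a b : List B} (ha : M.Matched a)
    (h : M.BraidEquiv a b) {s t : B} (hst : M s t = 3) : Precedes a s t ↔ Precedes b s t := by
  induction h with
  | refl => rfl
  | tail h1 h ih => exact ih.trans ((ha.of_braidEquiv h1).precedes_iff_of_braidStep h hst)

theorem Matched.cross_iff_of_braidEquiv {a b : List B} (ha : M.Matched a)
    (h : M.BraidEquiv a b) {s t : B} (hst : M s t = 3) : Cross a s t ↔ Cross b s t :=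
  and_congr (ha.precedes_iff_of_braidEquiv h hst)
    (ha.precedes_iff_of_braidEquiv h (by rw [M.symmetric, hst]))

/-- A repeated letter `s` has a partner `t` that then occurs only once, and crossing forces `t` to
lie between the two occurrences of `s`. -/
theorem Matched.ne_append_cons_cons {a : List B} (ha : M.Matched a) (u v : List B) (s : B) :
    a ≠ u ++ s :: s :: v := by
  rintro rfl
  obtain ⟨t, hst, hc⟩ := ha.exists_cross (s := s) (by simp; omega)
  have h1 := ha.count_add_count hst hc
  have hne := ne_of_three hst
  obtain ⟨h2, h3⟩ := hc
  have h4 := List.count_pos_iff.2 h2.mem_right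
  have h5 : s ∉ u ∧ s ∉ v := by
    simp [hne] at h1 h4
    simp only [← List.count_pos_iff] at h4
    simp only [← List.count_eq_zero]
    omega
  have h6 : ¬(t ∈ u ∧ t ∈ v) := by
    rintro ⟨h6, h7⟩
    rw [← List.count_pos_iff] at h6 h7
    simp [hne] at h1
    omega
  simp only [precedes_append, precedes_cons, List.mem_cons] at h2 h3
  have := @Precedes.mem_left B
  have := @Precedes.mem_right B
  grind

/-- Two neighbouring letters that cross in a matched word can be made to form a braid. -/
theorem Matched.exists_braid (hM : M.IsSimplyLaced) {a : List B} (ha : M.Matched a) {s t : B}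
    (hst : M s t = 3) (h : Cross a s t) : ∃ u v, M.BraidEquiv a (u ++ s :: t :: s :: v) := by
  -- One letter of the pair occurs twice. If it is `t`, build `t s t` and apply one more braid move.
  wlog hs : 2 ≤ a.count s generalizing s t
  · have h1 := ha.count_add_count hst h
    have hts : M t s = 3 := by rw [M.symmetric, hst]
    obtain ⟨u, v, e⟩ := this hts h.symm (by omega)
    exact ⟨u, v, e.tail (.braid u v hts)⟩
  have h1 := ha.count_add_count hst h
  have hne := ne_of_three hst
  have h2 := List.count_pos_iff.2 h.1.mem_right
  obtain ⟨x, y, rfl⟩ := List.append_of_mem h.1.mem_right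
  have hs2 : (x ++ t :: y).count s = 2 := by omega
  have ht1 : (x ++ t :: y).count t = 1 := by omega
  have htx : t ∉ x ∧ t ∉ y := by
    simp at ht1
    simp only [← List.count_eq_zero]
    omega
  obtain ⟨h3, h4⟩ := h
  simp only [precedes_append, precedes_cons, List.mem_cons] at h3 h4
  have hmr := @Precedes.mem_right B
  have hml := @Precedes.mem_left B
  have hsx : s ∈ x := by grind
  have hsy : s ∈ y := by grind
  obtain ⟨x1, x2, rfl⟩ := List.append_of_mem hsx
  obtain ⟨y1, y2, rfl⟩ := List.append_of_mem hsy
  have hs0 : s ∉ x2 ∧ s ∉ y1 := by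
    simp [hne.symm] at hs2
    simp only [← List.count_eq_zero]
    omega
  -- The word is now `x1 s x2 t y1 s y2`. A neighbour `z` of `s` between the two `s` would cross
  -- `s`, hence be `t`, which occurs only once. So both `s` can be moved next to `t`.
  have key : ∀ z, z ∈ x2 ∨ z ∈ y1 → M s z = 2 := by
    intro z hz
    refine (hM s z (by rintro rfl; exact hz.elim hs0.1 hs0.2)).resolve_right fun hsz => ?_
    have hzt : z = t := ha.unique hsz hst
      (by rcases hz with hz | hz <;> simp [Cross, precedes_append, precedes_cons, hz])
      (by simp [Cross, precedes_append, precedes_cons])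
    subst hzt
    rcases hz with hz | hz <;> simp [hz] at htx
  have e1 := braidEquiv_cons_concat (M := M) (b := x2) fun z hz => key z (.inl hz)
  have e2 := (braidEquiv_cons_concat (M := M) (b := y1) fun z hz => key z (.inr hz)).symm
  refine ⟨x1 ++ x2, y1 ++ y2, ?_⟩
  have e3 := e1.append x1 (t :: (y1 ++ s :: y2))
  have e4 := e2.append (x1 ++ x2 ++ [s, t]) y2
  simp only [List.append_assoc, List.cons_append, List.nil_append] at e3 e4 ⊢
  exact e3.trans e4

end Words

end CoxeterMatrix

namespace CoxeterSystem

open CoxeterMatrix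

section MatchedElements

variable {B : Type*} {W : Type*} [Group W] {M : CoxeterMatrix B} (cs : CoxeterSystem M W)
  [DecidableEq B]

/-- By Tits' theorem a word that is not reduced reaches some `u s s v` by braid moves, and that word
would still be matched. -/
theorem isReduced_of_matched (hM : M.IsSimplyLaced) {a : List B} (ha : M.Matched a) :
    cs.IsReduced a := by
  by_contra h
  obtain ⟨u, s, v, e⟩ := cs.exists_braidEquiv_of_not_isReduced hM h
  exact (ha.of_braidEquiv e).ne_append_cons_cons u v s rfl

theorem braidEquiv_of_matched (hM : M.IsSimplyLaced) {a b : List B} (ha : M.Matched a)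
    (hb : cs.IsReduced b) (h : cs.wordProd a = cs.wordProd b) : M.BraidEquiv a b :=
  cs.braidEquiv_of_wordProd_eq hM (cs.isReduced_of_matched hM ha) hb h

end MatchedElements

end CoxeterSystem

/-! ### Contractible triples by peeling off descents -/

namespace CoxeterSystem

open CoxeterMatrix

section Contractible

variable {B : Type*} {W : Type*} [Group W] {M : CoxeterMatrix B} (cs : CoxeterSystem M W)

theorem simpleReflection_apply_of_ne {i k : B} (h : i ≠ k) (v : B →₀ ℝ) :
    simpleReflection M k v i = v i := by
  rw [simpleReflection_apply]
  simp [simpleRoot, h.symm]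

theorem reflectionRep_simple_simple (p : B) (x : B →₀ ℝ) :
    cs.reflectionRep (cs.simple p) (cs.reflectionRep (cs.simple p) x) = x := by
  rw [← reflectionRep_mul_apply]; simp

theorem image_image_simple (p : B) (T : Set (B →₀ ℝ)) :
    cs.reflectionRep (cs.simple p) '' (cs.reflectionRep (cs.simple p) '' T) = T := by
  simp [Set.image_image, reflectionRep_simple_simple]

theorem mem_image_simple {p : B} {x : B →₀ ℝ} {T : Set (B →₀ ℝ)} :
    x ∈ cs.reflectionRep (cs.simple p) '' T ↔ cs.reflectionRep (cs.simple p) x ∈ T := by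
  constructor
  · rintro ⟨y, hy, rfl⟩
    rwa [reflectionRep_simple_simple]
  · exact fun h => ⟨_, h, cs.reflectionRep_simple_simple p x⟩

theorem rootSeq_append (u v : List B) :
    cs.rootSeq (u ++ v) =
      cs.rootSeq v ++ (cs.rootSeq u).map (cs.reflectionRep (cs.wordProd v)⁻¹) := by
  induction u with
  | nil => simp [rootSeq]
  | cons i u ih => simp [rootSeq, ih, wordProd_append]

theorem rootSeq_append_singleton (u : List B) (s : B) :
    cs.rootSeq (u ++ [s]) =
      simpleRoot s :: (cs.rootSeq u).map (cs.reflectionRep (cs.simple s)) := by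
  simp [rootSeq_append, rootSeq]

theorem mem_rootSeq {a : List B} {β : B →₀ ℝ} :
    β ∈ cs.rootSeq a ↔
      ∃ u i v, a = u ++ i :: v ∧ β = cs.reflectionRep (cs.wordProd v)⁻¹ (simpleRoot i) := by
  induction a with
  | nil => simp [rootSeq]
  | cons j a ih =>
    simp only [rootSeq, List.mem_append, ih, List.mem_singleton]
    constructor
    · rintro (⟨u, i, v, rfl, rfl⟩ | rfl)
      · exact ⟨j :: u, i, v, rfl, rfl⟩
      · exact ⟨[], j, a, rfl, rfl⟩
    · rintro ⟨u, i, v, h, rfl⟩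
      cases u with
      | nil =>
        obtain ⟨rfl, rfl⟩ := by simpa using h
        exact .inr rfl
      | cons k u =>
        obtain ⟨rfl, rfl⟩ := by simpa using h
        exact .inl ⟨u, i, v, rfl, rfl⟩

theorem nonneg_of_isReduced_cons (hM : M.IsSimplyLaced) {i : B} {v : List B}
    (h : cs.IsReduced (i :: v)) : 0 ≤ cs.reflectionRep (cs.wordProd v)⁻¹ (simpleRoot i) := by
  have h1 := h.reverse
  rw [List.reverse_cons, isReduced_append_singleton, wordProd_reverse] at h1
  exact cs.reflectionRep_simpleRoot_nonneg hM h1.2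

theorem mem_inversionSet_of_mem_rootSeq (hM : M.IsSimplyLaced) {a : List B}
    (ha : cs.IsReduced a) {β : B →₀ ℝ} (h : β ∈ cs.rootSeq a) :
    β ∈ cs.inversionSet (cs.wordProd a) := by
  obtain ⟨u, i, v, rfl, rfl⟩ := cs.mem_rootSeq.1 h
  have h1 : cs.reflectionRep (cs.wordProd (u ++ i :: v))
      (cs.reflectionRep (cs.wordProd v)⁻¹ (simpleRoot i)) =
      -cs.reflectionRep (cs.wordProd u) (simpleRoot i) := by
    rw [← reflectionRep_mul_apply, ← reflectionRep_mul_simple_self]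
    congr 2
    simp [wordProd_append, wordProd_cons, mul_assoc]
  refine ⟨⟨⟨_, _, rfl⟩, cs.nonneg_of_isReduced_cons hM (cs.isReduced_of_append_right ha)⟩, ?_⟩
  rw [h1]
  refine ⟨⟨cs.wordProd u, i, by simp⟩, ?_⟩
  rw [neg_neg]
  have h2 : cs.IsReduced (u ++ [i] ++ v) := by simpa using ha
  exact cs.reflectionRep_simpleRoot_nonneg hM
    (cs.isReduced_append_singleton.1 (cs.isReduced_of_append_left h2)).2

theorem not_isReduced_append_cons_cons (u v : List B) (s : B) :
    ¬cs.IsReduced (u ++ s :: s :: v) := by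
  intro h
  have h1 : cs.IsReduced (u ++ [s] ++ [s]) := cs.isReduced_of_append_left (v := v) (by simpa using h)
  have h2 := cs.isReduced_append_singleton.1 h1
  exact h2.2 (cs.isRightDescent_of_isReduced_append_singleton h2.1)

theorem not_isReduced_append_of_two (u v : List B) {s t : B} (hst : M s t = 2) :
    ¬cs.IsReduced (u ++ s :: t :: s :: v) := by
  intro h
  have := cs.isReduced_of_braidEquiv (.single (.swap u (s :: v) hst)) h
  exact cs.not_isReduced_append_cons_cons (u ++ [t]) v s (by simpa using this)

/-- The sets of three roots that appear, up to the action of a right factor, in a braid at the end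
of a reduced word of an element. -/
inductive Contractible : W → Set (B →₀ ℝ) → Prop
  | braid {w : W} {s t : B} (hst : M s t = 3) (hs : cs.IsRightDescent w s)
      (ht : cs.IsRightDescent w t) :
      Contractible w {simpleRoot s, simpleRoot t, simpleRoot s + simpleRoot t}
  | step {w : W} {p : B} {T : Set (B →₀ ℝ)} (hp : cs.IsRightDescent w p)
      (h : Contractible (w * cs.simple p) (cs.reflectionRep (cs.simple p) '' T)) :
      Contractible w T

theorem rootSeq_braid {s t : B} (h : M s t = 3) :
    cs.rootSeq [s, t, s] = [simpleRoot s, simpleRoot t + simpleRoot s, simpleRoot t] := by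
  have h' : M t s = 3 := by rw [M.symmetric, h]
  simp [rootSeq, wordProd_cons, reflectionRep_simple, simpleReflection_simpleRoot_of_three h,
    simpleReflection_simpleRoot_of_three h', simpleReflection_simpleRoot_self]

theorem Contractible.exists_rootSeq (hM : M.IsSimplyLaced) {w : W} {T : Set (B →₀ ℝ)}
    (h : cs.Contractible w T) : (∃ α β : B →₀ ℝ, T = {α, β, α + β}) ∧
      ∃ (r₁ r₂ : List (B →₀ ℝ)) (a b c : B →₀ ℝ),
        cs.IsRootSeq w (r₁ ++ [a, b, c] ++ r₂) ∧ T = {a, b, c} := by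
  induction h with
  | @braid w s t hst hs ht =>
    refine ⟨⟨_, _, rfl⟩, ?_⟩
    obtain ⟨a, ha, rfl⟩ := cs.exists_isReduced_append_braid hM hst hs ht
    refine ⟨[], (cs.rootSeq a).map (cs.reflectionRep (cs.wordProd [s, t, s])⁻¹), simpleRoot s,
      simpleRoot t + simpleRoot s, simpleRoot t, ⟨_, ha, rfl, ?_⟩, ?_⟩
    · rw [rootSeq_append, rootSeq_braid _ hst]
      rfl
    · ext x
      simp [add_comm (simpleRoot s)]
      tauto
  | @step w p T hp h ih =>
    obtain ⟨⟨α, β, hT⟩, r₁, r₂, a, b, c, ⟨ω, hω, hw, hr⟩, hT'⟩ := ih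
    constructor
    · refine ⟨cs.reflectionRep (cs.simple p) α, cs.reflectionRep (cs.simple p) β, ?_⟩
      rw [← cs.image_image_simple p T, hT]
      simp [Set.image_insert_eq]
    · obtain ⟨h1, h2⟩ := cs.isReduced_append_singleton_of_isRightDescent hp hω hw
      refine ⟨simpleRoot p :: r₁.map (cs.reflectionRep (cs.simple p)),
        r₂.map (cs.reflectionRep (cs.simple p)), cs.reflectionRep (cs.simple p) a,
        cs.reflectionRep (cs.simple p) b, cs.reflectionRep (cs.simple p) c,
        ⟨ω ++ [p], h1, h2, ?_⟩, ?_⟩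
      · rw [rootSeq_append_singleton, ← hr]
        simp
      · rw [← cs.image_image_simple p T, hT']
        simp [Set.image_insert_eq]

/-- Removing the last letter of the word removes the first root and applies that simple reflection
to the others. This brings the three roots to the front, where they come from the last three letters
of the word. -/
theorem contractible_of_rootSeq (hM : M.IsSimplyLaced) {ω : List B} (hω : cs.IsReduced ω)
    {r₁ r₂ : List (B →₀ ℝ)} {a b c α β : B →₀ ℝ} (hr : cs.rootSeq ω = r₁ ++ [a, b, c] ++ r₂)
    (hT : ({a, b, c} : Set (B →₀ ℝ)) = {α, β, α + β}) :
    cs.Contractible (cs.wordProd ω) {a, b, c} := by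
  induction hn : r₁.length generalizing ω r₁ r₂ a b c α β with
  | zero =>
    obtain rfl := List.length_eq_zero_iff.1 hn
    rcases List.eq_nil_or_concat' ω with rfl | ⟨ω, k, rfl⟩
    · simp [rootSeq] at hr
    rcases List.eq_nil_or_concat' ω with rfl | ⟨ω, j, rfl⟩
    · simp [rootSeq] at hr
    rcases List.eq_nil_or_concat' ω with rfl | ⟨ω, i, rfl⟩
    · simp [rootSeq] at hr
    have e : ω ++ [i] ++ [j] ++ [k] = ω ++ [i, j, k] := by simp
    rw [e] at hω hr ⊢
    have hij : i ≠ j := by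
      rintro rfl
      exact cs.not_isReduced_append_cons_cons _ _ _ hω
    have hjk : j ≠ k := by
      rintro rfl
      exact cs.not_isReduced_append_cons_cons (ω ++ [i]) [] _ (by simpa using hω)
    by_cases hik : i = k
    · subst hik
      rcases hM i j hij with h2 | h3
      · exact (cs.not_isReduced_append_of_two ω [] h2 hω).elim
      · rw [rootSeq_append, rootSeq_braid _ h3] at hr
        obtain ⟨rfl, rfl, rfl, -⟩ := by simpa using hr
        have e0 : M.BraidEquiv (ω ++ [i, j, i]) (ω ++ [j, i, j]) :=
          .single (BraidStep.braid ω [] h3)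
        have hω' := cs.isReduced_of_braidEquiv e0 hω
        have q1 : ω ++ [i, j, i] = (ω ++ [i, j]) ++ [i] := by simp
        have q2 : ω ++ [j, i, j] = (ω ++ [j, i]) ++ [j] := by simp
        have hi := cs.isRightDescent_of_isReduced_append_singleton (q1 ▸ hω)
        have hj := cs.isRightDescent_of_isReduced_append_singleton (q2 ▸ hω')
        rw [← q1] at hi
        rw [← q2, ← cs.wordProd_eq_of_braidEquiv e0] at hj
        have := Contractible.braid h3 hi hj
        convert this using 1
        ext x
        simp [add_comm (simpleRoot i)]
        tauto
    -- The last letters `i, j, k` with `i` different from `j` and `k` give the roots `α_k`, `s_k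
    -- α_j`, `s_k s_j α_i`, whose coordinates at `α_i` are `0, 0, 1`. No three nonzero vectors with
    -- these coordinates form a set `{α, β, α + β}`.
    · exfalso
      rw [rootSeq_append] at hr
      simp only [rootSeq, wordProd_cons, wordProd_nil, List.nil_append, List.cons_append,
        mul_one, mul_inv_rev, inv_simple, List.cons.injEq, inv_one, map_one,
        Module.End.one_apply] at hr
      obtain ⟨rfl, rfl, rfl, -⟩ := hr
      set x := simpleRoot k (B := B) with hx
      set y := cs.reflectionRep (cs.simple k) (simpleRoot j) with hy
      set z := cs.reflectionRep (cs.simple k * cs.simple j) (simpleRoot i) with hz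
      have hx0 : x ≠ 0 := simpleRoot_ne_zero k
      have hy0 : y ≠ 0 := cs.reflectionRep_simpleRoot_ne_zero _ _
      have hxi : x i = 0 := by simp [hx, simpleRoot, Ne.symm hik]
      have hyi : y i = 0 := by
        rw [hy, reflectionRep_simple, simpleReflection_apply_of_ne hik]
        simp [simpleRoot, Ne.symm hij]
      have hzi : z i = 1 := by
        rw [hz, reflectionRep_mul_apply, reflectionRep_simple, reflectionRep_simple,
          simpleReflection_apply_of_ne hik, simpleReflection_apply_of_ne hij]
        simp [simpleRoot]
      have key : ∀ v ∈ ({α, β, α + β} : Set (B →₀ ℝ)), v = x ∨ v = y ∨ v = z := by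
        rw [← hT]
        simp
      have hα := key α (by simp)
      have hβ := key β (by simp)
      have hs := key (α + β) (by simp)
      have hzm : z = α ∨ z = β ∨ z = α + β := by
        have : z ∈ ({α, β, α + β} : Set (B →₀ ℝ)) := by
          rw [← hT]
          simp
        simpa using this
      have val : ∀ v, v = x ∨ v = y ∨ v = z → v ≠ 0 ∧ (v i = 0 ∨ v i = 1 ∧ v = z) := by
        rintro v (rfl | rfl | rfl)
        · exact ⟨hx0, .inl hxi⟩
        · exact ⟨hy0, .inl hyi⟩
        · refine ⟨fun h => ?_, .inr ⟨hzi, rfl⟩⟩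
          rw [h] at hzi
          simp at hzi
      obtain ⟨hα0, hα1⟩ := val _ hα
      obtain ⟨hβ0, hβ1⟩ := val _ hβ
      obtain ⟨-, hs1⟩ := val _ hs
      rw [Finsupp.add_apply] at hs1
      rcases hα1 with h1 | ⟨h1, h1'⟩ <;> rcases hβ1 with h2 | ⟨h2, h2'⟩
      · rcases hzm with h | h | h
        · rw [h, h1] at hzi; norm_num at hzi
        · rw [h, h2] at hzi; norm_num at hzi
        · rw [h, Finsupp.add_apply, h1, h2] at hzi; norm_num at hzi
      · rcases hs1 with h | ⟨-, h⟩
        · rw [h1, h2] at h; norm_num at h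
        · rw [h2'] at h
          exact hα0 (by simpa using h)
      · rcases hs1 with h | ⟨-, h⟩
        · rw [h1, h2] at h; norm_num at h
        · rw [h1'] at h
          exact hβ0 (by simpa using h)
      · rw [h1, h2] at hs1
        norm_num at hs1
  | succ n ih =>
    obtain ⟨r, r₁, rfl⟩ := List.exists_cons_of_length_eq_add_one hn
    rcases List.eq_nil_or_concat' ω with rfl | ⟨ω, p, rfl⟩
    · simp [rootSeq] at hr
    have hω' := cs.isReduced_of_append_left hω
    rw [rootSeq_append_singleton, List.cons_append, List.cons_append, List.cons.injEq] at hr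
    have hr' := congrArg (List.map (cs.reflectionRep (cs.simple p))) hr.2
    rw [List.map_map, List.map_congr_left (g := id) (by simp [reflectionRep_simple_simple]),
      List.map_id] at hr'
    simp only [List.map_append, List.map_cons, List.map_nil] at hr'
    have hT' := congrArg (Set.image (cs.reflectionRep (cs.simple p))) hT
    simp only [Set.image_insert_eq, Set.image_singleton, map_add] at hT'
    refine .step (cs.isRightDescent_of_isReduced_append_singleton hω) ?_
    rw [wordProd_append_singleton]
    simpa [Set.image_insert_eq] using ih hω' hr' hT' (by simpa using hn)

/-- The inductive form makes it possible to argue one descent at a time, with no reduced word fixed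
in advance. -/
theorem mem_contractibleTriples_iff (hM : M.IsSimplyLaced) {w : W} {T : Set (B →₀ ℝ)} :
    T ∈ cs.contractibleTriples w ↔ cs.Contractible w T := by
  constructor
  · rintro ⟨⟨-, α, β, hT⟩, r₁, r₂, a, b, c, ⟨ω, hω, rfl, hr⟩, rfl⟩
    exact cs.contractible_of_rootSeq hM hω hr.symm hT
  · intro h
    obtain ⟨h1, r₁, r₂, a, b, c, ⟨ω, hω, hw, hr⟩, hT⟩ := h.exists_rootSeq cs hM
    refine ⟨⟨?_, h1⟩, r₁, r₂, a, b, c, ⟨ω, hω, hw, hr⟩, hT⟩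
    subst hw
    intro x hx
    refine cs.mem_inversionSet_of_mem_rootSeq hM hω ?_
    rw [← hr]
    rw [hT] at hx
    simp at hx ⊢
    tauto

theorem Contractible.subset_inversionSet (hM : M.IsSimplyLaced) {w : W} {T : Set (B →₀ ℝ)}
    (h : cs.Contractible w T) : T ⊆ cs.inversionSet w :=
  ((cs.mem_contractibleTriples_iff hM).2 h).1.1

theorem Contractible.nonneg (hM : M.IsSimplyLaced) {w : W} {T : Set (B →₀ ℝ)}
    (h : cs.Contractible w T) {x : B →₀ ℝ} (hx : x ∈ T) : 0 ≤ x :=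
  (h.subset_inversionSet cs hM hx).1.2

theorem Contractible.isRightDescent (hM : M.IsSimplyLaced) {w : W} {T : Set (B →₀ ℝ)}
    (h : cs.Contractible w T) {s : B} (hx : simpleRoot s ∈ T) : cs.IsRightDescent w s := by
  have h1 := (h.subset_inversionSet cs hM hx).2.2
  rw [cs.isRightDescent_iff_nonpos hM]
  exact neg_nonneg.1 h1

end Contractible

end CoxeterSystem

/-! ### Roots attached to the letters of a word -/

namespace CoxeterSystem

open CoxeterMatrix

section LetterRoots

variable {B : Type*} {W : Type*} [Group W] {M : CoxeterMatrix B} (cs : CoxeterSystem M W)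

/-- The roots of the root sequence of a word that come from the letters in `P`. -/
def letterRoots (P : Set B) (a : List B) : Set (B →₀ ℝ) :=
  {β | ∃ u i v, a = u ++ i :: v ∧ i ∈ P ∧ β = cs.reflectionRep (cs.wordProd v)⁻¹ (simpleRoot i)}

theorem letterRoots_nil (P : Set B) : cs.letterRoots P [] = ∅ := by
  ext
  simp [letterRoots]

theorem letterRoots_cons (P : Set B) (i : B) (a : List B) :
    cs.letterRoots P (i :: a) = cs.letterRoots P a ∪
      {β | i ∈ P ∧ β = cs.reflectionRep (cs.wordProd a)⁻¹ (simpleRoot i)} := by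
  ext β
  constructor
  · rintro ⟨u, j, v, h, hj, rfl⟩
    cases u with
    | nil =>
      obtain ⟨rfl, rfl⟩ := by simpa using h
      exact .inr ⟨hj, rfl⟩
    | cons k u =>
      obtain ⟨rfl, rfl⟩ := by simpa using h
      exact .inl ⟨u, j, v, rfl, hj, rfl⟩
  · rintro (⟨u, j, v, rfl, hj, rfl⟩ | ⟨hj, rfl⟩)
    · exact ⟨i :: u, j, v, rfl, hj, rfl⟩
    · exact ⟨[], i, a, rfl, hj, rfl⟩

theorem letterRoots_append (P : Set B) (a b : List B) :
    cs.letterRoots P (a ++ b) = cs.letterRoots P b ∪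
      cs.reflectionRep (cs.wordProd b)⁻¹ '' cs.letterRoots P a := by
  induction a with
  | nil => simp [letterRoots_nil]
  | cons i a ih =>
    rw [List.cons_append, letterRoots_cons, letterRoots_cons, ih, Set.image_union, Set.union_assoc]
    congr 2
    ext β
    simp only [wordProd_append, mul_inv_rev, reflectionRep_mul_apply, Set.mem_ofPred_eq,
      Set.mem_image]
    constructor
    · rintro ⟨h, rfl⟩
      exact ⟨_, ⟨h, rfl⟩, rfl⟩
    · rintro ⟨_, ⟨h, rfl⟩, rfl⟩
      exact ⟨h, rfl⟩

theorem letterRoots_eq_empty {P : Set B} {a : List B} (h : ∀ i ∈ a, i ∉ P) :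
    cs.letterRoots P a = ∅ := by
  rw [Set.eq_empty_iff_forall_notMem]
  rintro β ⟨u, i, v, rfl, hi, -⟩
  exact h i (by simp) hi

theorem mem_rootSeq_iff_mem_letterRoots {a : List B} {β : B →₀ ℝ} :
    β ∈ cs.rootSeq a ↔ β ∈ cs.letterRoots Set.univ a := by
  simp [mem_rootSeq, letterRoots]

theorem letterRoots_congr {P : Set B} {c d : List B} (h : cs.letterRoots P c = cs.letterRoots P d)
    (h' : cs.wordProd c = cs.wordProd d) (u v : List B) :
    cs.letterRoots P (u ++ (c ++ v)) = cs.letterRoots P (u ++ (d ++ v)) := by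
  simp only [letterRoots_append, wordProd_append, h, h']

theorem letterRoots_swap {P : Set B} {s t : B} (h : M s t = 2) (u v : List B) :
    cs.letterRoots P (u ++ s :: t :: v) = cs.letterRoots P (u ++ t :: s :: v) := by
  refine cs.letterRoots_congr (c := [s, t]) (d := [t, s]) ?_
    (cs.wordProd_eq_of_braidStep (.swap [] [] h)) u v
  have h' : M t s = 2 := by rw [M.symmetric, h]
  simp [letterRoots_cons, letterRoots_nil, reflectionRep_simple,
    simpleReflection_simpleRoot_of_two h, simpleReflection_simpleRoot_of_two h', Set.union_comm]

theorem letterRoots_braid_word {P : Set B} {s t : B} (h : M s t = 3) (hs : s ∈ P) (ht : t ∈ P) :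
    cs.letterRoots P [s, t, s] = {simpleRoot s, simpleRoot t, simpleRoot s + simpleRoot t} := by
  have h' : M t s = 3 := by rw [M.symmetric, h]
  ext x
  simp [letterRoots_cons, letterRoots_nil, hs, ht, wordProd_cons, reflectionRep_simple,
    simpleReflection_simpleRoot_of_three h, simpleReflection_simpleRoot_of_three h',
    simpleReflection_simpleRoot_self, add_comm (simpleRoot t)]
  tauto

/-- The two sides of a braid move carry the same three roots but distribute them differently between
`s` and `t`, so `P` has to contain both letters or neither. -/
theorem letterRoots_braid {P : Set B} {s t : B} (h : M s t = 3) (hP : s ∈ P ↔ t ∈ P)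
    (u v : List B) :
    cs.letterRoots P (u ++ s :: t :: s :: v) = cs.letterRoots P (u ++ t :: s :: t :: v) := by
  refine cs.letterRoots_congr (c := [s, t, s]) (d := [t, s, t]) ?_
    (cs.wordProd_eq_of_braidStep (.braid [] [] h)) u v
  have h' : M t s = 3 := by rw [M.symmetric, h]
  by_cases hs : s ∈ P
  · have ht := hP.1 hs
    rw [letterRoots_braid_word _ h hs ht, letterRoots_braid_word _ h' ht hs, Set.insert_comm,
      add_comm]
  · have ht : t ∉ P := fun h => hs (hP.2 h)
    rw [letterRoots_eq_empty, letterRoots_eq_empty] <;> simp [hs, ht]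

theorem letterRoots_univ_eq_of_braidEquiv {a b : List B} (h : M.BraidEquiv a b) :
    cs.letterRoots Set.univ a = cs.letterRoots Set.univ b := by
  induction h with
  | refl => rfl
  | tail _ h ih =>
    rw [ih]
    cases h with
    | swap u v h => exact cs.letterRoots_swap h u v
    | braid u v h => exact cs.letterRoots_braid h (by simp) u v

/-- In a reduced word the roots at distinct letters are distinct. -/
theorem disjoint_letterRoots (hM : M.IsSimplyLaced) {P Q : Set B} (hPQ : Disjoint P Q)
    {a : List B} (ha : cs.IsReduced a) : Disjoint (cs.letterRoots P a) (cs.letterRoots Q a) := by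
  -- If the root of the first letter `i` recurs at a letter `j`, with `u` the word between them,
  -- cancelling the common right factor leaves `u⁻¹ α_i = -α_j`. This contradicts positivity, since
  -- `i :: u` is reduced.
  have key : ∀ {i : B} {a : List B} {R : Set B}, cs.IsReduced (i :: a) →
      cs.reflectionRep (cs.wordProd a)⁻¹ (simpleRoot i) ∉ cs.letterRoots R a := by
    rintro i a R ha ⟨u, j, v, rfl, -, h⟩
    have e : cs.reflectionRep (cs.wordProd (u ++ j :: v))⁻¹ (simpleRoot i) =
        cs.reflectionRep (cs.wordProd v)⁻¹ (cs.reflectionRep (cs.simple j)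
          (cs.reflectionRep (cs.wordProd u)⁻¹ (simpleRoot i))) := by
      rw [← reflectionRep_mul_apply, ← reflectionRep_mul_apply]
      simp [wordProd_append, wordProd_cons, mul_assoc]
    rw [e] at h
    have h1 := cs.reflectionRep_injective _ h
    have h2 := congrArg (cs.reflectionRep (cs.simple j)) h1
    rw [reflectionRep_simple_simple, reflectionRep_simple, simpleReflection_simpleRoot_self] at h2
    have h3 := cs.nonneg_of_isReduced_cons hM (cs.isReduced_of_append_left (u := i :: u) ha)
    rw [h2] at h3
    exact simpleRoot_ne_zero j (le_antisymm (neg_nonneg.1 h3) (simpleRoot_nonneg j))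
  induction a with
  | nil => simp [letterRoots_nil]
  | cons i a ih =>
    have h1 := ih (cs.isReduced_of_append_right (u := [i]) ha)
    rw [Set.disjoint_left] at *
    rw [letterRoots_cons, letterRoots_cons]
    rintro β (hβ | ⟨hi, rfl⟩) (hβ' | ⟨hi', hβ'⟩)
    · exact h1 hβ hβ'
    · rw [hβ'] at hβ
      exact key ha hβ
    · exact key ha hβ'
    · exact hPQ hi hi'

theorem contractible_of_isReduced {u v : List B} {s t : B}
    (hst : M s t = 3) (h : cs.IsReduced (u ++ s :: t :: s :: v)) :
    cs.Contractible (cs.wordProd (u ++ s :: t :: s :: v))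
      (cs.reflectionRep (cs.wordProd v)⁻¹ ''
        {simpleRoot s, simpleRoot t, simpleRoot s + simpleRoot t}) := by
  induction v using List.reverseRecOn with
  | nil =>
    have e0 : M.BraidEquiv (u ++ [s, t, s]) (u ++ [t, s, t]) := .single (BraidStep.braid u [] hst)
    have h' := cs.isReduced_of_braidEquiv e0 h
    have q1 : u ++ [s, t, s] = (u ++ [s, t]) ++ [s] := by simp
    have q2 : u ++ [t, s, t] = (u ++ [t, s]) ++ [t] := by simp
    have hi := cs.isRightDescent_of_isReduced_append_singleton (q1 ▸ h)
    have hj := cs.isRightDescent_of_isReduced_append_singleton (q2 ▸ h')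
    rw [← q1] at hi
    rw [← q2, ← cs.wordProd_eq_of_braidEquiv e0] at hj
    simpa using Contractible.braid hst hi hj
  | append_singleton v p ih =>
    have e : u ++ s :: t :: s :: (v ++ [p]) = (u ++ s :: t :: s :: v) ++ [p] := by simp
    rw [e] at h ⊢
    refine .step (cs.isRightDescent_of_isReduced_append_singleton h) ?_
    have := ih (cs.isReduced_of_append_left h)
    convert this using 1
    · rw [wordProd_append_singleton]; simp
    · simp only [wordProd_append_singleton, mul_inv_rev, inv_simple, Set.image_image,
        reflectionRep_mul_apply, reflectionRep_simple_simple]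

theorem Contractible.exists_isReduced (hM : M.IsSimplyLaced) {w : W} {T : Set (B →₀ ℝ)}
    (h : cs.Contractible w T) : ∃ u v s t, M s t = 3 ∧ cs.IsReduced (u ++ s :: t :: s :: v) ∧
      cs.wordProd (u ++ s :: t :: s :: v) = w ∧ T = cs.reflectionRep (cs.wordProd v)⁻¹ ''
        {simpleRoot s, simpleRoot t, simpleRoot s + simpleRoot t} := by
  induction h with
  | @braid w s t hst hs ht =>
    obtain ⟨u, h1, h2⟩ := cs.exists_isReduced_append_braid hM hst hs ht
    exact ⟨u, [], s, t, hst, h1, h2, by simp⟩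
  | @step w p T hp h ih =>
    obtain ⟨u, v, s, t, hst, h1, h2, h3⟩ := ih
    obtain ⟨h4, h5⟩ := cs.isReduced_append_singleton_of_isRightDescent hp h1 h2
    refine ⟨u, v ++ [p], s, t, hst, by simpa using h4, by simpa using h5, ?_⟩
    rw [← cs.image_image_simple p T, h3]
    simp only [wordProd_append_singleton, mul_inv_rev, inv_simple, Set.image_image,
        reflectionRep_mul_apply]

/-- By Matsumoto's theorem the set of roots of a root sequence depends only on the element, not on
the reduced word. -/
theorem Contractible.mem_rootSeq (hM : M.IsSimplyLaced) {ω : List B} (hω : cs.IsReduced ω)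
    {T : Set (B →₀ ℝ)} (hT : cs.Contractible (cs.wordProd ω) T) {x : B →₀ ℝ} (hx : x ∈ T) :
    x ∈ cs.rootSeq ω := by
  obtain ⟨-, r₁, r₂, a, b, c, ⟨ω', hω', hw, hr⟩, rfl⟩ := hT.exists_rootSeq cs hM
  have e := cs.braidEquiv_of_wordProd_eq hM hω' hω hw
  rw [mem_rootSeq_iff_mem_letterRoots, ← letterRoots_univ_eq_of_braidEquiv _ e,
    ← mem_rootSeq_iff_mem_letterRoots, ← hr]
  simp at hx ⊢
  tauto

theorem finite_contractibleTriples (hM : M.IsSimplyLaced) (w : W) :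
    (cs.contractibleTriples w).Finite := by
  obtain ⟨ω, hω, rfl⟩ := cs.exists_isReduced w
  refine ((List.finite_toSet (cs.rootSeq ω)).powerset).subset fun T hT x hx => ?_
  exact ((cs.mem_contractibleTriples_iff hM).1 hT).mem_rootSeq cs hM hω hx

end LetterRoots

/-! ### Freely braided elements and removal of a descent -/

section FreelyBraided

variable {B : Type*} {W : Type*} [Group W] {M : CoxeterMatrix B} (cs : CoxeterSystem M W)

theorem isFreelyBraided_iff (hM : M.IsSimplyLaced) {w : W} :
    cs.IsFreelyBraided w ↔ ∀ T T', cs.Contractible w T → cs.Contractible w T' →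
      ∀ x, x ∈ T → x ∈ T' → T = T' := by
  simp only [IsFreelyBraided, Set.PairwiseDisjoint, Set.Pairwise, Function.onFun, id,
    cs.mem_contractibleTriples_iff hM]
  constructor
  · intro h T T' hT hT' x hx hx'
    by_contra hne
    exact Set.disjoint_left.1 (h hT hT' hne) hx hx'
  · intro h T hT T' hT' hne
    rw [Set.disjoint_left]
    exact fun x hx hx' => hne (h T T' hT hT' x hx hx')

theorem IsFreelyBraided.eq (hM : M.IsSimplyLaced) {w : W} (hw : cs.IsFreelyBraided w)
    {T T' : Set (B →₀ ℝ)} (hT : cs.Contractible w T) (hT' : cs.Contractible w T') {x : B →₀ ℝ}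
    (hx : x ∈ T) (hx' : x ∈ T') : T = T' :=
  (cs.isFreelyBraided_iff hM).1 hw T T' hT hT' x hx hx'

theorem Contractible.of_mul_simple {w : W} {s : B} (hs : cs.IsRightDescent w s)
    {T : Set (B →₀ ℝ)} (h : cs.Contractible (w * cs.simple s) T) :
    cs.Contractible w (cs.reflectionRep (cs.simple s) '' T) :=
  .step hs (by rwa [image_image_simple])

theorem image_simple_injective (s : B) :
    Function.Injective (fun T : Set (B →₀ ℝ) => cs.reflectionRep (cs.simple s) '' T) :=
  Set.image_injective.2 (cs.reflectionRep_injective _)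

/-- The reflection `s` carries the contractible triples of `w s` injectively into those of `w`, so
disjointness is inherited. -/
theorem IsFreelyBraided.mul_simple (hM : M.IsSimplyLaced) {w : W} (hw : cs.IsFreelyBraided w)
    {s : B} (hs : cs.IsRightDescent w s) : cs.IsFreelyBraided (w * cs.simple s) := by
  rw [cs.isFreelyBraided_iff hM]
  intro T T' hT hT' x hx hx'
  exact cs.image_simple_injective s (hw.eq cs hM (hT.of_mul_simple cs hs) (hT'.of_mul_simple cs hs)
    (Set.mem_image_of_mem _ hx) (Set.mem_image_of_mem _ hx'))

theorem reflectionRep_simple_of_three {s t : B} (h : M s t = 3) :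
    cs.reflectionRep (cs.simple s) (simpleRoot t) = simpleRoot t + simpleRoot s := by
  rw [reflectionRep_simple, simpleReflection_simpleRoot_of_three h]

theorem reflectionRep_simple_of_two {s t : B} (h : M s t = 2) :
    cs.reflectionRep (cs.simple s) (simpleRoot t) = simpleRoot t := by
  rw [reflectionRep_simple, simpleReflection_simpleRoot_of_two h]

theorem reflectionRep_simple_self (s : B) :
    cs.reflectionRep (cs.simple s) (simpleRoot s) = -simpleRoot s := by
  rw [reflectionRep_simple, simpleReflection_simpleRoot_self]

/-- In a freely braided element, a contractible triple that does not contain the simple root of a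
descent is contractible without that descent. -/
theorem Contractible.mul_simple (hM : M.IsSimplyLaced) {w : W} (hw : cs.IsFreelyBraided w)
    {T : Set (B →₀ ℝ)} (hT : cs.Contractible w T) {s : B} (hs : cs.IsRightDescent w s)
    (hsT : simpleRoot s ∉ T) :
    cs.Contractible (w * cs.simple s) (cs.reflectionRep (cs.simple s) '' T) := by
  induction hn : cs.length w using Nat.strong_induction_on generalizing w T s with
  | _ n ih =>
  subst hn
  have hT0 := hT
  cases hT with
  | @braid _ p q hpq hp hq =>
    simp only [Set.mem_insert_iff, Set.mem_singleton_iff, not_or] at hsT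
    have hsp : s ≠ p := fun h => hsT.1 (by rw [h])
    have hsq : s ≠ q := fun h => hsT.2.1 (by rw [h])
    -- If `s` were a neighbour of `p` or `q`, the braid triple on these two descents would meet `T`
    -- and hence equal it, although `α_s` is not in `T`.
    have aux : ∀ r, r = p ∨ r = q → M s r = 2 := by
      intro r hr
      refine (hM s r (by rintro rfl; tauto)).resolve_right fun h3 => ?_
      have hr' : cs.IsRightDescent w r := by rcases hr with rfl | rfl <;> assumption
      have := hw.eq cs hM hT0 (.braid h3 hs hr') (x := simpleRoot r)
        (by rcases hr with rfl | rfl <;> simp) (by simp)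
      have h4 : simpleRoot s ∈ ({simpleRoot p, simpleRoot q, simpleRoot p + simpleRoot q} :
        Set (B →₀ ℝ)) := by rw [this]; simp
      simp at h4
      tauto
    have h2p := aux p (.inl rfl)
    have h2q := aux q (.inr rfl)
    have := Contractible.braid hpq ((cs.isRightDescent_mul_simple_of_two hM h2p).2 hp)
      ((cs.isRightDescent_mul_simple_of_two hM h2q).2 hq)
    simpa [Set.image_insert_eq, reflectionRep_simple_of_two _ h2p, reflectionRep_simple_of_two _ h2q]
      using this
  | @step _ p _ hp hT =>
    by_cases hps : p = s
    · exact hps ▸ hT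
    have hwp := hw.mul_simple cs hM hp
    rcases hM p s hps with h2 | h3
    · have h2' : M s p = 2 := by rw [M.symmetric, h2]
      have hs' := (cs.isRightDescent_mul_simple_of_two hM h2).2 hs
      have hp' := (cs.isRightDescent_mul_simple_of_two hM h2').2 hp
      have h4 := ih _ hp hwp hT hs'
        (by rwa [mem_image_simple, reflectionRep_simple_of_two _ h2]) rfl
      refine .step hp' ?_
      rw [mul_assoc, ← cs.simple_mul_comm h2, ← mul_assoc]
      convert h4 using 1
      simp only [Set.image_image, ← reflectionRep_mul_apply, cs.simple_mul_comm h2]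
    · have h3' : M s p = 3 := by rw [M.symmetric, h3]
      -- With `p` and `s` neighbouring descents, `T` differs from their braid triple and so is
      -- disjoint from it. Hence `p`, `s`, `p` can be peeled off in turn by induction: each time the
      -- excluded simple root pulls back to a root of the braid triple.
      have hT1 : Contractible cs w {simpleRoot p, simpleRoot s, simpleRoot p + simpleRoot s} :=
        .braid h3 hp hs
      have hsp : ∀ x ∈ ({simpleRoot p, simpleRoot s, simpleRoot p + simpleRoot s} :
          Set (B →₀ ℝ)), x ∉ T := by
        intro x hx hxT
        exact hsT (by rw [hw.eq cs hM hT0 hT1 hxT hx]; simp)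
      have hs1 := cs.isRightDescent_mul_simple_of_three hM h3 hp hs
      have h4 := ih _ hp hwp hT hs1 (by
        rw [mem_image_simple, reflectionRep_simple_of_three _ h3, add_comm]
        exact hsp _ (by simp)) rfl
      have hp1 := (cs.isRightDescent_mul_simple_mul_simple_of_three hM h3).2 hs
      have h5 := ih _ (hs1.trans hp) (hwp.mul_simple cs hM hs1) h4 hp1 (by
        rw [mem_image_simple, mem_image_simple, reflectionRep_simple_of_three _ h3', map_add,
          reflectionRep_simple_self, reflectionRep_simple_of_three _ h3]
        simpa using hsp (simpleRoot s) (by simp)) rfl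
      have hp2 := cs.isRightDescent_mul_simple_of_three hM h3' hs hp
      have hs2 := (cs.isRightDescent_mul_simple_mul_simple_of_three hM h3').2 hp
      have hb := cs.simple_braid h3
      -- Because `p s p = s p s`, what remains after `p, s, p` is also what remains after `s, p, s`.
      -- Putting back the last two letters arrives at `w s`.
      refine .step hp2 (.step hs2 ?_)
      convert h5 using 1
      · simp only [mul_assoc] at hb ⊢
        rw [hb]
      · simp only [Set.image_image, ← reflectionRep_mul_apply]
        simp only [← mul_assoc] at hb ⊢
        rw [hb]

/-- In a freely braided element, a contractible triple that contains a simple root comes from a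
braid followed by letters commuting with that root. -/
theorem Contractible.exists_isReduced_of_mem (hM : M.IsSimplyLaced) {w : W}
    (hw : cs.IsFreelyBraided w) {T : Set (B →₀ ℝ)} (hT : cs.Contractible w T) {s : B}
    (hsT : simpleRoot s ∈ T) :
    ∃ u v x, M s v = 3 ∧ (∀ y ∈ x, M s y = 2) ∧ cs.IsReduced (u ++ s :: v :: s :: x) ∧
      cs.wordProd (u ++ s :: v :: s :: x) = w ∧ T = cs.reflectionRep (cs.wordProd x)⁻¹ ''
        {simpleRoot s, simpleRoot v, simpleRoot s + simpleRoot v} := by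
  have base : ∀ {w : W} {v : B}, M s v = 3 → cs.IsRightDescent w s → cs.IsRightDescent w v →
      ∃ u v' x, M s v' = 3 ∧ (∀ y ∈ x, M s y = 2) ∧ cs.IsReduced (u ++ s :: v' :: s :: x) ∧
      cs.wordProd (u ++ s :: v' :: s :: x) = w ∧
      {simpleRoot s, simpleRoot v, simpleRoot s + simpleRoot v} = cs.reflectionRep (cs.wordProd x)⁻¹ ''
        {simpleRoot s, simpleRoot v', simpleRoot s + simpleRoot v'} := by
    intro w v h3 hs hv
    obtain ⟨u, h1, h2⟩ := cs.exists_isReduced_append_braid hM h3 hs hv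
    exact ⟨u, v, [], h3, by simp, h1, h2, by simp⟩
  have hs := hT.isRightDescent cs hM hsT
  induction hT with
  | @braid w p q hpq hp hq =>
    have hpq' : M q p = 3 := by rw [M.symmetric, hpq]
    have hne := ne_of_three hpq
    simp only [Set.mem_insert_iff, Set.mem_singleton_iff] at hsT
    rcases hsT with h | h | h
    · obtain rfl := simpleRoot_injective h
      exact base hpq hp hq
    · obtain rfl := simpleRoot_injective h
      have := base hpq' hq hp
      rwa [Set.insert_comm, add_comm (simpleRoot s)] at this
    · exfalso
      have e1 := DFunLike.congr_fun h p
      have e2 := DFunLike.congr_fun h q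
      have h1 : s = p := by
        by_contra h1
        simp [simpleRoot, hne, h1] at e1
      have h2 : s = q := by
        by_contra h2
        simp [simpleRoot, hne.symm, h2] at e2
      exact hne (h1.symm.trans h2)
  | @step w p T hp hT ih =>
    have hT0 : cs.Contractible w T := .step hp hT
    -- Otherwise the triple of `w s` would contain `-α_s`, which is not positive.
    have hps : p ≠ s := by
      rintro rfl
      have h1 := hT.nonneg cs hM (x := -simpleRoot p)
        (by rw [mem_image_simple, map_neg, reflectionRep_simple_self, neg_neg]; exact hsT)
      exact simpleRoot_ne_zero p (le_antisymm (neg_nonneg.1 h1) (simpleRoot_nonneg p))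
    rcases hM s p hps.symm with h2 | h3
    · have h2' : M p s = 2 := by rw [M.symmetric, h2]
      obtain ⟨u, v, x, hsv, hx, h1, h2, h3⟩ := ih (hw.mul_simple cs hM hp)
        (by rwa [mem_image_simple, reflectionRep_simple_of_two _ h2'])
        ((cs.isRightDescent_mul_simple_of_two hM h2').2 hs)
      obtain ⟨h4, h5⟩ := cs.isReduced_append_singleton_of_isRightDescent hp h1 h2
      refine ⟨u, v, x ++ [p], hsv, ?_, by simpa using h4, by simpa using h5, ?_⟩
      · intro y hy
        rcases List.mem_append.1 hy with hy | hy
        · exact hx y hy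
        · obtain rfl := by simpa using hy
          assumption
      · rw [← cs.image_image_simple p T, h3]
        simp only [wordProd_append_singleton, mul_inv_rev, inv_simple, Set.image_image,
          reflectionRep_mul_apply]
    -- If `p` is a neighbour of `s`, both are descents, and their braid triple contains `α_s`; by
    -- disjointness it is `T`.
    · have := base h3 hs hp
      rwa [hw.eq cs hM hT0 (.braid h3 hs hp) hsT (by simp)]

end FreelyBraided

end CoxeterSystem

/-! ### Products of matched words are content maximal -/

namespace CoxeterSystem

open CoxeterMatrix

section MatchedTriples

variable {B : Type*} {W : Type*} [Group W] {M : CoxeterMatrix B} (cs : CoxeterSystem M W)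
  [DecidableEq B]

/-- Since crossing pairs form a matching, a braid on `p, q` involves both letters of the crossing
pair `s, t` or neither, which is the condition needed in `letterRoots_braid`. -/
theorem letterRoots_eq_of_braidStep {a b : List B} (ha : M.Matched a) (h : M.BraidStep a b)
    {s t : B} (hst : M s t = 3) (hc : Cross a s t) :
    cs.letterRoots {s, t} a = cs.letterRoots {s, t} b := by
  cases h with
  | swap u v h => exact cs.letterRoots_swap h u v
  | @braid u v p q h =>
    have hpq : Cross (u ++ p :: q :: p :: v) p q := by
      simp [Cross, precedes_append, precedes_cons]
    have h' : M q p = 3 := by rw [M.symmetric, h]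
    have hts : M t s = 3 := by rw [M.symmetric, hst]
    refine cs.letterRoots_braid h ?_ u v
    simp only [Set.mem_insert_iff, Set.mem_singleton_iff]
    constructor
    · rintro (rfl | rfl)
      · exact .inr (ha.unique h hst hpq hc)
      · exact .inl (ha.unique h hts hpq hc.symm)
    · rintro (rfl | rfl)
      · exact .inr (ha.unique h' hst hpq.symm hc)
      · exact .inl (ha.unique h' hts hpq.symm hc.symm)

theorem letterRoots_eq_of_braidEquiv {a b : List B} (ha : M.Matched a) (h : M.BraidEquiv a b)
    {s t : B} (hst : M s t = 3) (hc : Cross a s t) :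
    cs.letterRoots {s, t} a = cs.letterRoots {s, t} b := by
  induction h with
  | refl => rfl
  | tail h1 h ih =>
    exact ih.trans (cs.letterRoots_eq_of_braidStep (ha.of_braidEquiv h1) h hst
      ((ha.cross_iff_of_braidEquiv h1 hst).1 hc))

theorem letterRoots_pair_of_braid {u v : List B} {s t : B}
    (h : M.Matched (u ++ s :: t :: s :: v)) (hst : M s t = 3) :
    cs.letterRoots {s, t} (u ++ s :: t :: s :: v) = cs.reflectionRep (cs.wordProd v)⁻¹ ''
      {simpleRoot s, simpleRoot t, simpleRoot s + simpleRoot t} := by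
  obtain ⟨h1, h2, h3, h4⟩ := h.notMem_of_braid hst
  have e : s :: t :: s :: v = [s, t, s] ++ v := rfl
  have hne : ∀ {c : List B}, s ∉ c → t ∉ c → cs.letterRoots {s, t} c = ∅ := by
    intro c hs ht
    refine cs.letterRoots_eq_empty fun i hi h => ?_
    rcases h with rfl | rfl
    · exact hs hi
    · exact ht hi
  rw [e, letterRoots_append, letterRoots_append, hne h1 h3, hne h2 h4,
    letterRoots_braid_word _ hst (by simp) (by simp)]
  simp

/-- The contractible triples of the element of a matched word are given by its crossing pairs of
neighbouring letters. -/
theorem contractible_iff_of_matched (hM : M.IsSimplyLaced) {a : List B} (ha : M.Matched a)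
    {T : Set (B →₀ ℝ)} : cs.Contractible (cs.wordProd a) T ↔
      ∃ s t, M s t = 3 ∧ Cross a s t ∧ T = cs.letterRoots {s, t} a := by
  constructor
  · intro h
    obtain ⟨u, v, s, t, hst, h1, h2, rfl⟩ := h.exists_isReduced cs hM
    have e := cs.braidEquiv_of_matched hM ha h1 h2.symm
    have hc : Cross a s t := (ha.cross_iff_of_braidEquiv e hst).2
      (by simp [Cross, precedes_append, precedes_cons])
    refine ⟨s, t, hst, hc, ?_⟩
    rw [cs.letterRoots_eq_of_braidEquiv ha e hst hc,
      cs.letterRoots_pair_of_braid (ha.of_braidEquiv e) hst]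
  · rintro ⟨s, t, hst, hc, rfl⟩
    obtain ⟨u, v, e⟩ := ha.exists_braid hM hst hc
    have hb := ha.of_braidEquiv e
    rw [cs.letterRoots_eq_of_braidEquiv ha e hst hc, cs.letterRoots_pair_of_braid hb hst,
      cs.wordProd_eq_of_braidEquiv e]
    exact cs.contractible_of_isReduced hst (cs.isReduced_of_matched hM hb)

/-- Crossing pairs with a common letter coincide, and disjoint sets of letters carry disjoint sets
of roots in a reduced word. -/
theorem eq_or_eq_of_mem_letterRoots (hM : M.IsSimplyLaced) {a : List B} (ha : M.Matched a)
    {s t s' t' : B} (hst : M s t = 3) (hst' : M s' t' = 3) (hc : Cross a s t)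
    (hc' : Cross a s' t') {x : B →₀ ℝ} (hx : x ∈ cs.letterRoots {s, t} a)
    (hx' : x ∈ cs.letterRoots {s', t'} a) : (s = s' ∧ t = t') ∨ (s = t' ∧ t = s') := by
  have hts : M t s = 3 := by rw [M.symmetric, hst]
  have hts' : M t' s' = 3 := by rw [M.symmetric, hst']
  by_cases h1 : s = s'
  · subst h1
    exact .inl ⟨rfl, ha.unique hst hst' hc hc'⟩
  by_cases h2 : s = t'
  · subst h2
    exact .inr ⟨rfl, ha.unique hst hts' hc hc'.symm⟩
  by_cases h3 : t = s'
  · subst h3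
    exact .inr ⟨ha.unique hts hst' hc.symm hc', rfl⟩
  by_cases h4 : t = t'
  · subst h4
    exact .inl ⟨ha.unique hts hts' hc.symm hc'.symm, rfl⟩
  refine (Set.disjoint_left.1 (cs.disjoint_letterRoots hM ?_ (cs.isReduced_of_matched hM ha))
    hx hx').elim
  rw [Set.disjoint_left]
  rintro y (rfl | rfl) (h | h) <;> first | exact h1 h | exact h2 h | exact h3 h | exact h4 h

theorem isFreelyBraided_of_matched (hM : M.IsSimplyLaced) {a : List B} (ha : M.Matched a) :
    cs.IsFreelyBraided (cs.wordProd a) := by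
  rw [cs.isFreelyBraided_iff hM]
  intro T T' hT hT' x hx hx'
  obtain ⟨s, t, hst, hc, rfl⟩ := (cs.contractible_iff_of_matched hM ha).1 hT
  obtain ⟨s', t', hst', hc', rfl⟩ := (cs.contractible_iff_of_matched hM ha).1 hT'
  rcases cs.eq_or_eq_of_mem_letterRoots hM ha hst hst' hc hc' hx hx' with
    ⟨rfl, rfl⟩ | ⟨rfl, rfl⟩
  · rfl
  · rw [Set.pair_comm]

theorem count_le_two_of_matched {a : List B} (ha : M.Matched a) (s : B) : a.count s ≤ 2 := by
  by_contra h
  obtain ⟨t, hst, hc⟩ := ha.exists_cross (s := s) (by omega)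
  have := ha.count_add_count hst hc
  have := List.count_pos_iff.2 hc.1.mem_right
  omega

/-- Each crossing pair has counts `2` and `1`, so sending a letter that occurs twice to the triple
of its pair is a bijection. -/
theorem ncard_contractibleTriples_of_matched (hM : M.IsSimplyLaced) {a : List B}
    (ha : M.Matched a) : (cs.contractibleTriples (cs.wordProd a)).ncard =
      (a.toFinset.filter fun s => a.count s = 2).card := by
  have hex : ∀ s, ∃ t, a.count s = 2 → M s t = 3 ∧ Cross a s t := by
    intro s
    by_cases hs : a.count s = 2
    · obtain ⟨t, ht⟩ := ha.exists_cross (s := s) hs.ge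
      exact ⟨t, fun _ => ht⟩
    · exact ⟨s, fun h => (hs h).elim⟩
  choose f hf using hex
  have e : cs.contractibleTriples (cs.wordProd a) =
      (fun s => cs.letterRoots {s, f s} a) '' (a.toFinset.filter fun s => a.count s = 2) := by
    ext T
    rw [cs.mem_contractibleTriples_iff hM, cs.contractible_iff_of_matched hM ha]
    simp only [Set.mem_image, Finset.coe_filter, List.mem_toFinset, Set.mem_ofPred_eq]
    constructor
    · rintro ⟨s, t, hst, hc, rfl⟩
      have hts : M t s = 3 := by rw [M.symmetric, hst]
      have h1 := ha.count_add_count hst hc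
      have h2 := List.count_pos_iff.2 hc.1.mem_left
      have h3 := List.count_pos_iff.2 hc.1.mem_right
      by_cases hs : a.count s = 2
      · refine ⟨s, ⟨hc.1.mem_left, hs⟩, ?_⟩
        rw [ha.unique (hf s hs).1 hst (hf s hs).2 hc]
      · have ht : a.count t = 2 := by omega
        refine ⟨t, ⟨hc.1.mem_right, ht⟩, ?_⟩
        rw [ha.unique (hf t ht).1 hts (hf t ht).2 hc.symm, Set.pair_comm]
    · rintro ⟨s, ⟨-, hs⟩, rfl⟩
      exact ⟨s, f s, (hf s hs).1, (hf s hs).2, rfl⟩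
  rw [e, Set.InjOn.ncard_image, Set.ncard_coe_finset]
  intro s hs s' hs' h
  simp only [Finset.coe_filter, List.mem_toFinset, Set.mem_ofPred_eq] at hs hs' h
  obtain ⟨u, v, huv⟩ := List.append_of_mem hs.1
  have hx : cs.reflectionRep (cs.wordProd v)⁻¹ (simpleRoot s) ∈ cs.letterRoots {s, f s} a :=
    ⟨u, s, v, huv, by simp, rfl⟩
  have h1 := hf s hs.2
  have h2 := hf s' hs'.2
  rcases cs.eq_or_eq_of_mem_letterRoots hM ha h1.1 h2.1 h1.2 h2.2 hx (h ▸ hx) with h3 | h3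
  · exact h3.1
  · have := ha.count_add_count h1.1 h1.2
    rw [h3.2, hs.2, hs'.2] at this
    omega

/-- The length is the number of distinct letters plus the number of letters that occur twice, and
the latter is the number of triples. -/
theorem isContentMaximal_of_matched (hM : M.IsSimplyLaced) {a : List B} (ha : M.Matched a) :
    cs.IsContentMaximal (cs.wordProd a) := by
  have hr := cs.isReduced_of_matched hM ha
  refine ⟨cs.isFreelyBraided_of_matched hM ha, ?_⟩
  have h1 : (cs.support (cs.wordProd a)).ncard = a.toFinset.card := by
    rw [cs.support_eq hM hr, ← Set.ncard_coe_finset, List.coe_toFinset]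
  have h2 : a.length = a.toFinset.card + (a.toFinset.filter fun s => a.count s = 2).card := by
    rw [← List.sum_toFinset_count_eq_length, Finset.card_eq_sum_ones, Finset.card_filter,
      ← Finset.sum_add_distrib]
    refine Finset.sum_congr rfl fun s hs => ?_
    have h3 := List.count_pos_iff.2 (List.mem_toFinset.1 hs)
    have h4 := count_le_two_of_matched ha s
    split_ifs <;> omega
  rw [h1, cs.ncard_contractibleTriples_of_matched hM ha, hr, h2]
  push_cast
  ring

end MatchedTriples

end CoxeterSystem

/-! ### Enlarging a matched word at its end -/

namespace CoxeterMatrix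

section Insertion

variable {B : Type*} {M : CoxeterMatrix B} [DecidableEq B]

theorem Matched.append_singleton {a : List B} (ha : M.Matched a) {s : B} (hs : s ∉ a) :
    M.Matched (a ++ [s]) := by
  have hp : ∀ {p q}, Precedes (a ++ [s]) p q ↔ Precedes a p q ∨ (p ∈ a ∧ q = s) := by
    intro p q
    simp [precedes_append, precedes_cons, not_precedes_nil]
  have hmr := @Precedes.mem_right B
  have hml := @Precedes.mem_left B
  have hc : ∀ {p q}, Cross (a ++ [s]) p q ↔ Cross a p q := by
    intro p q
    simp only [Cross, hp]
    grind
  refine ⟨fun {p q} h h' => ?_, fun h1 h2 h3 h4 => ha.unique h1 h2 (hc.1 h3) (hc.1 h4),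
    fun {p} h => ?_⟩
  · have h1 := hc.1 h'
    have h2 := ha.count_add_count h h1
    have h3 : p ≠ s := by
      rintro rfl
      exact hs h1.1.mem_left
    have h4 : q ≠ s := by
      rintro rfl
      exact hs h1.1.mem_right
    simpa [h3.symm, h4.symm] using h2
  · have h3 : p ≠ s := by
      rintro rfl
      simp [List.count_eq_zero.2 hs] at h
    obtain ⟨t, h1, h2⟩ := ha.exists_cross (s := p) (by simpa [h3.symm] using h)
    exact ⟨t, h1, hc.2 h2⟩

theorem Matched.notMem_of_not_cross {u v : List B} {s : B} (h : M.Matched (u ++ s :: v))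
    (hs : ∀ t, M s t = 3 → ¬Cross (u ++ s :: v) s t) : s ∉ u ∧ s ∉ v := by
  have h1 : ¬2 ≤ (u ++ s :: v).count s := fun h2 => by
    obtain ⟨t, h3, h4⟩ := h.exists_cross h2
    exact hs t h3 h4
  simp at h1
  simp only [← List.count_eq_zero]
  omega

/-- Two adjacent neighbouring letters that do not cross any neighbour can be completed to a
braid. -/
theorem Matched.append_braid {u x : List B} {s v : B} (h : M.Matched (u ++ s :: v :: x))
    (hsv : M s v = 3) (hx : ∀ y ∈ x, M s y = 2)
    (hs : ∀ t, M s t = 3 → ¬Cross (u ++ s :: v :: x) s t)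
    (hv : ∀ t, M v t = 3 → ¬Cross (u ++ s :: v :: x) v t) :
    M.Matched (u ++ s :: v :: (x ++ [s])) := by
  have hne := ne_of_three hsv
  obtain ⟨hsu, hsx⟩ := h.notMem_of_not_cross hs
  obtain ⟨hvu, hvx⟩ := Matched.notMem_of_not_cross (u := u ++ [s]) (v := x) (by simpa using h)
    (by simpa using hv)
  simp only [List.mem_append, List.mem_cons, List.not_mem_nil, not_or] at hsx hvu
  have hp : ∀ {p q}, Precedes (u ++ s :: v :: (x ++ [s])) p q ↔
      Precedes (u ++ s :: v :: x) p q ∨ (p ∈ u ++ s :: v :: x ∧ q = s) := by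
    intro p q
    have e : u ++ s :: v :: (x ++ [s]) = (u ++ s :: v :: x) ++ [s] := by simp
    rw [e, precedes_append]
    simp [precedes_cons, not_precedes_nil]
  have hc : ∀ {p q}, p ≠ s → q ≠ s →
      (Cross (u ++ s :: v :: (x ++ [s])) p q ↔ Cross (u ++ s :: v :: x) p q) := by
    intro p q h1 h2
    simp only [Cross, hp, h1, h2, and_false, or_false]
  -- A neighbour of `s` that crosses `s` must occur after the first `s`, hence be `v`, since the
  -- letters of `x` commute with `s`.
  have hsz : ∀ {z}, M s z = 3 → Cross (u ++ s :: v :: (x ++ [s])) s z → z = v := by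
    intro z hz hcr
    have h1 := (hp.1 hcr.1).resolve_right fun h1 => ne_of_three hz h1.2.symm
    have hzx : z ∉ x := fun h2 => by
      have := hx z h2
      omega
    have hml := @Precedes.mem_left B
    have hmr := @Precedes.mem_right B
    simp only [precedes_append, precedes_cons, List.mem_cons] at h1
    have := ne_of_three hz
    grind
  have hcsv : Cross (u ++ s :: v :: (x ++ [s])) s v := by
    simp [Cross, precedes_append, precedes_cons]
  have hvz : ∀ {z}, M v z = 3 → Cross (u ++ s :: v :: (x ++ [s])) v z → z = s := by
    intro z hz hcr
    by_contra h1
    exact hv z hz ((hc hne.symm h1).1 hcr)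
  have hcs : (u ++ s :: v :: (x ++ [s])).count s = 2 := by
    simp [List.count_eq_zero.2 hsu, List.count_eq_zero.2 hsx.2, hne.symm]
  have hcv : (u ++ s :: v :: (x ++ [s])).count v = 1 := by
    simp [List.count_eq_zero.2 hvu.1, List.count_eq_zero.2 hvx, hne]
  have hcount : ∀ {p}, p ≠ s → (u ++ s :: v :: (x ++ [s])).count p =
      (u ++ s :: v :: x).count p := by
    intro p hp
    simp [hp.symm, List.count_cons]
  refine ⟨fun {p q} hpq hcr => ?_, fun {p q q'} hpq hpq' hcr hcr' => ?_, fun {p} hp2 => ?_⟩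
  · by_cases h1 : p = s
    · subst h1
      rw [hsz hpq hcr, hcs, hcv]
    by_cases h2 : q = s
    · subst h2
      rw [hsz (by rw [M.symmetric, hpq]) hcr.symm, hcs, hcv]
    rw [hcount h1, hcount h2]
    exact h.count_add_count hpq ((hc h1 h2).1 hcr)
  · by_cases h1 : p = s
    · subst h1
      rw [hsz hpq hcr, hsz hpq' hcr']
    by_cases h2 : p = v
    · subst h2
      rw [hvz hpq hcr, hvz hpq' hcr']
    have key : ∀ {z}, M p z = 3 → Cross (u ++ s :: v :: (x ++ [s])) p z → z ≠ s := by
      rintro z hz hcr rfl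
      exact h2 (hsz (by rw [M.symmetric, hz]) hcr.symm)
    exact h.unique hpq hpq' ((hc h1 (key hpq hcr)).1 hcr) ((hc h1 (key hpq' hcr')).1 hcr')
  · by_cases h1 : p = s
    · subst h1
      exact ⟨v, hsv, hcsv⟩
    rw [hcount h1] at hp2
    obtain ⟨t, ht, hcr⟩ := h.exists_cross hp2
    have h2 : t ≠ s := by
      rintro rfl
      exact hs p (by rw [M.symmetric, ht]) hcr.symm
    exact ⟨t, ht, (hc h1 h2).2 hcr⟩

end Insertion

end CoxeterMatrix

/-! ### Content maximal elements have matched words -/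

namespace CoxeterSystem

open CoxeterMatrix

section ContentMaximal

variable {B : Type*} {W : Type*} [Group W] {M : CoxeterMatrix B} (cs : CoxeterSystem M W)

theorem simple_mul_wordProd_comm {s : B} {x : List B} (h : ∀ y ∈ x, M s y = 2) :
    cs.simple s * cs.wordProd x = cs.wordProd x * cs.simple s := by
  have := cs.wordProd_eq_of_braidEquiv (braidEquiv_cons_concat h)
  rwa [wordProd_cons, wordProd_append_singleton] at this

theorem reflectionRep_wordProd_inv_simpleRoot {s : B} {x : List B} (h : ∀ y ∈ x, M s y = 2) :
    cs.reflectionRep (cs.wordProd x)⁻¹ (simpleRoot s) = simpleRoot s := by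
  induction x with
  | nil => simp
  | cons y x ih =>
    rw [wordProd_cons, mul_inv_rev, inv_simple, reflectionRep_mul_apply,
      reflectionRep_simple_of_two _ (by rw [M.symmetric]; exact h y (by simp))]
    exact ih fun z hz => h z (by simp [hz])

theorem ncard_le_of_forall_notMem (hM : M.IsSimplyLaced) {w : W} (hw : cs.IsFreelyBraided w)
    {s : B} (hs : cs.IsRightDescent w s)
    (h : ∀ T, cs.Contractible w T → simpleRoot s ∉ T) :
    (cs.contractibleTriples w).ncard ≤ (cs.contractibleTriples (w * cs.simple s)).ncard := by
  refine Set.ncard_le_ncard_of_injOn _ (fun T hT => ?_) (cs.image_simple_injective s).injOn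
    (cs.finite_contractibleTriples hM _)
  rw [cs.mem_contractibleTriples_iff hM] at *
  exact hT.mul_simple cs hM hw hs (h T hT)

/-- By disjointness at most one triple contains `α_s`. All the others survive in `w s`. -/
theorem ncard_le_add_one (hM : M.IsSimplyLaced) {w : W} (hw : cs.IsFreelyBraided w)
    {s : B} (hs : cs.IsRightDescent w s) :
    (cs.contractibleTriples w).ncard ≤ (cs.contractibleTriples (w * cs.simple s)).ncard + 1 := by
  by_cases h : ∀ T, cs.Contractible w T → simpleRoot s ∉ T
  · exact (cs.ncard_le_of_forall_notMem hM hw hs h).trans (Nat.le_succ _)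
  push Not at h
  obtain ⟨T₀, hT₀, hs₀⟩ := h
  have h1 : (cs.contractibleTriples w \ {T₀}).ncard ≤
      (cs.contractibleTriples (w * cs.simple s)).ncard := by
    refine Set.ncard_le_ncard_of_injOn _ (fun T hT => ?_) (cs.image_simple_injective s).injOn
      (cs.finite_contractibleTriples hM _)
    rw [Set.mem_sdiff, cs.mem_contractibleTriples_iff hM] at hT
    rw [cs.mem_contractibleTriples_iff hM]
    exact hT.1.mul_simple cs hM hw hs fun h => hT.2 (hw.eq cs hM hT.1 hT₀ h hs₀)
  have := Set.ncard_le_ncard_sdiff_add_ncard (cs.contractibleTriples w) {T₀}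
  rw [Set.ncard_singleton] at this
  omega

theorem rootSeq_apply_eq_zero {a : List B} {s : B} (hs : s ∉ a) {γ : B →₀ ℝ}
    (hγ : γ ∈ cs.rootSeq a) : γ s = 0 := by
  obtain ⟨u, i, v, rfl, rfl⟩ := cs.mem_rootSeq.1 hγ
  have key : ∀ (x : List B) (y : B →₀ ℝ), s ∉ x → y s = 0 →
      cs.reflectionRep (cs.wordProd x)⁻¹ y s = 0 := by
    intro x
    induction x with
    | nil => simp
    | cons j x ih =>
      intro y hx hy
      rw [List.mem_cons, not_or] at hx
      rw [wordProd_cons, mul_inv_rev, inv_simple, reflectionRep_mul_apply]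
      refine ih _ hx.2 ?_
      rw [reflectionRep_simple, simpleReflection_apply_of_ne hx.1, hy]
  simp only [List.mem_append, List.mem_cons, not_or] at hs
  exact key _ _ hs.2.2 (by simp [simpleRoot, Ne.symm hs.2.1])

/-- If `α_s` were in `T`, then `T` would have the form `{α_s, β, α_s + β}`. The roots other than
`α_s` in the root sequence of `a ++ [s]` are `s γ` with `γ` free of `α_s`. So `s β` and `s (α_s + β)
= s β - α_s` would both have coordinate `0` at `α_s`, which is absurd. -/
theorem Contractible.notMem_of_notMem (hM : M.IsSimplyLaced) {w : W}
    (hw : cs.IsFreelyBraided w) {s : B} {a : List B} (ha : cs.IsReduced (a ++ [s]))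
    (haw : cs.wordProd (a ++ [s]) = w) (hs : s ∉ a) {T : Set (B →₀ ℝ)}
    (hT : cs.Contractible w T) : simpleRoot s ∉ T := by
  intro hsT
  obtain ⟨-, v, x, hsv, hx, -, -, rfl⟩ := hT.exists_isReduced_of_mem cs hM hw hsT
  have key : ∀ β ∈ cs.reflectionRep (cs.wordProd x)⁻¹ ''
      {simpleRoot s, simpleRoot v, simpleRoot s + simpleRoot v}, β ≠ simpleRoot s →
      cs.reflectionRep (cs.simple s) β s = 0 := by
    intro β hβ hne
    have h3 := (haw ▸ hT).mem_rootSeq cs hM ha hβ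
    rw [rootSeq_append_singleton, List.mem_cons] at h3
    obtain ⟨γ, hγ, rfl⟩ := List.mem_map.1 (h3.resolve_left hne)
    rw [reflectionRep_simple_simple]
    exact cs.rootSeq_apply_eq_zero hs hγ
  have hxs := cs.reflectionRep_wordProd_inv_simpleRoot hx
  have hne := ne_of_three hsv
  have h3 := key (cs.reflectionRep (cs.wordProd x)⁻¹ (simpleRoot v)) ⟨_, by simp, rfl⟩ (by
    intro h
    rw [← hxs] at h
    exact hne (simpleRoot_injective (cs.reflectionRep_injective _ h)).symm)
  have h4 := key (cs.reflectionRep (cs.wordProd x)⁻¹ (simpleRoot s + simpleRoot v))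
    ⟨_, by simp, rfl⟩ (by
    rw [map_add, hxs]
    intro h
    exact cs.reflectionRep_simpleRoot_ne_zero _ v (by simpa using h))
  rw [map_add, hxs, map_add, reflectionRep_simple_self, Finsupp.add_apply, h3] at h4
  simp [simpleRoot] at h4

theorem ncard_support_append_singleton (hM : M.IsSimplyLaced) {a : List B} {s : B}
    (ha : cs.IsReduced (a ++ [s])) (hs : s ∉ a) :
    (cs.support (cs.wordProd (a ++ [s]))).ncard = (cs.support (cs.wordProd a)).ncard + 1 := by
  rw [cs.support_eq hM ha, cs.support_eq hM (cs.isReduced_of_append_left ha)]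
  have e : {i | i ∈ a ++ [s]} = insert s {i | i ∈ a} := by
    ext
    simp [or_comm]
  rw [e]
  exact Set.ncard_insert_of_notMem (s := {i | i ∈ a}) hs (List.finite_toSet a)

theorem support_append_singleton (hM : M.IsSimplyLaced) {a : List B} {s : B}
    (ha : cs.IsReduced (a ++ [s])) (hs : s ∈ a) :
    cs.support (cs.wordProd (a ++ [s])) = cs.support (cs.wordProd a) := by
  rw [cs.support_eq hM ha, cs.support_eq hM (cs.isReduced_of_append_left ha)]
  ext i
  simp
  rintro rfl
  exact hs

/-- Removing a descent of a freely braided element does not increase `ℓ w - # supp w - N w`. -/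
theorem excess_mul_simple_le (hM : M.IsSimplyLaced) {a : List B} {s : B}
    (ha : cs.IsReduced (a ++ [s])) (hw : cs.IsFreelyBraided (cs.wordProd (a ++ [s]))) :
    (cs.support (cs.wordProd (a ++ [s]))).ncard +
      (cs.contractibleTriples (cs.wordProd (a ++ [s]))).ncard ≤
    (cs.support (cs.wordProd a)).ncard + (cs.contractibleTriples (cs.wordProd a)).ncard + 1 := by
  have hs := cs.isRightDescent_of_isReduced_append_singleton ha
  have e : cs.wordProd (a ++ [s]) * cs.simple s = cs.wordProd a := by
    rw [wordProd_append_singleton]; simp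
  by_cases hsa : s ∈ a
  · have h1 := cs.ncard_le_add_one hM hw hs
    rw [e] at h1
    rw [cs.support_append_singleton hM ha hsa]
    omega
  · have h1 := cs.ncard_le_of_forall_notMem hM hw hs fun T hT =>
      hT.notMem_of_notMem cs hM hw ha rfl hsa
    rw [e] at h1
    rw [cs.ncard_support_append_singleton hM ha hsa]
    omega

/-- Nonnegativity of `ℓ w - # supp w - N w`. Together with `excess_mul_simple_le` it forces the
quantity to stay `0` when a content maximal element is truncated. -/
theorem ncard_support_add_le (hM : M.IsSimplyLaced) {a : List B} (ha : cs.IsReduced a)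
    (hw : cs.IsFreelyBraided (cs.wordProd a)) :
    (cs.support (cs.wordProd a)).ncard + (cs.contractibleTriples (cs.wordProd a)).ncard ≤
      a.length := by
  induction a using List.reverseRecOn with
  | nil =>
    have h1 : cs.contractibleTriples (cs.wordProd []) = ∅ := by
      rw [Set.eq_empty_iff_forall_notMem]
      intro T hT
      obtain ⟨u, v, s, t, -, h1, h2, -⟩ :=
        ((cs.mem_contractibleTriples_iff hM).1 hT).exists_isReduced cs hM
      rw [IsReduced, h2] at h1
      simp at h1
    rw [h1, cs.support_eq hM ha]
    simp
  | append_singleton a s ih =>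
    have h1 := cs.excess_mul_simple_le hM ha hw
    have h2 := hw.mul_simple cs hM (cs.isRightDescent_of_isReduced_append_singleton ha)
    rw [wordProd_append_singleton, simple_mul_simple_cancel_right] at h2
    have h3 := ih (cs.isReduced_of_append_left ha) h2
    simp
    omega

theorem isContentMaximal_iff {a : List B} (ha : cs.IsReduced a) :
    cs.IsContentMaximal (cs.wordProd a) ↔ cs.IsFreelyBraided (cs.wordProd a) ∧
      (cs.support (cs.wordProd a)).ncard + (cs.contractibleTriples (cs.wordProd a)).ncard =
        a.length := by
  rw [IsContentMaximal, ha.eq]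
  refine and_congr_right fun _ => ?_
  omega

variable [DecidableEq B]

/-- A crossing at `s` or `v` gives a triple of `w s` whose image under `s` shares a root with the
triple of the braid `s v s`, hence equals it. The image then contains `α_s`, so the triple of `w s`
contains `-α_s`, which is impossible. -/
theorem not_cross_of_contractible (hM : M.IsSimplyLaced) {u x : List B} {s v : B}
    (hm : M.Matched (u ++ s :: v :: x)) (hsv : M s v = 3) (hx : ∀ y ∈ x, M s y = 2)
    {w : W} (hw : cs.IsFreelyBraided w) (hs : cs.IsRightDescent w s)
    (hws : cs.wordProd (u ++ s :: v :: x) = w * cs.simple s)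
    (hT : cs.Contractible w (cs.reflectionRep (cs.wordProd x)⁻¹ ''
      {simpleRoot s, simpleRoot v, simpleRoot s + simpleRoot v}))
    {p t : B} (hp : p = s ∨ p = v) (hpt : M p t = 3) : ¬Cross (u ++ s :: v :: x) p t := by
  intro hc
  have h1 := (cs.contractible_iff_of_matched hM hm).2 ⟨p, t, hpt, hc, rfl⟩
  rw [hws] at h1
  have h2 := h1.of_mul_simple cs hs
  have hvs : M v s = 3 := by rw [M.symmetric, hsv]
  have hcomm : ∀ y, cs.reflectionRep (cs.simple s) (cs.reflectionRep (cs.wordProd x)⁻¹ y) =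
      cs.reflectionRep (cs.wordProd x)⁻¹ (cs.reflectionRep (cs.simple s) y) := by
    intro y
    have := cs.simple_mul_wordProd_comm hx
    have h3 : cs.simple s * (cs.wordProd x)⁻¹ = (cs.wordProd x)⁻¹ * cs.simple s := by
      rw [eq_inv_mul_iff_mul_eq, ← mul_assoc, ← this]
      simp
    rw [← reflectionRep_mul_apply, h3, reflectionRep_mul_apply]
  have h3 : cs.reflectionRep (cs.simple s) '' cs.letterRoots {p, t} (u ++ s :: v :: x) =
      cs.reflectionRep (cs.wordProd x)⁻¹ ''
        {simpleRoot s, simpleRoot v, simpleRoot s + simpleRoot v} := by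
    rcases hp with rfl | rfl
    · refine hw.eq cs hM h2 hT (x := cs.reflectionRep (cs.wordProd x)⁻¹ (simpleRoot v))
        ?_ ⟨_, by simp, rfl⟩
      refine ⟨_, ⟨u, p, v :: x, rfl, by simp, rfl⟩, ?_⟩
      rw [wordProd_cons, mul_inv_rev, inv_simple, reflectionRep_mul_apply, hcomm,
        reflectionRep_simple_of_three _ hvs, map_add, reflectionRep_simple_self,
        reflectionRep_simple_of_three _ hsv]
      simp
    · refine hw.eq cs hM h2 hT
        (x := cs.reflectionRep (cs.wordProd x)⁻¹ (simpleRoot s + simpleRoot p))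
        ?_ ⟨_, by simp, rfl⟩
      refine ⟨_, ⟨u ++ [s], p, x, by simp, by simp, rfl⟩, ?_⟩
      rw [hcomm, reflectionRep_simple_of_three _ hsv, add_comm]
  have h4 : simpleRoot s ∈ cs.reflectionRep (cs.simple s) ''
      cs.letterRoots {p, t} (u ++ s :: v :: x) := by
    rw [h3]
    exact ⟨_, by simp, cs.reflectionRep_wordProd_inv_simpleRoot hx⟩
  rw [mem_image_simple, reflectionRep_simple_self] at h4
  exact simpleRoot_ne_zero s
    (le_antisymm (neg_nonneg.1 (h1.nonneg cs hM h4)) (simpleRoot_nonneg s))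

theorem exists_matched_of_isContentMaximal (hM : M.IsSimplyLaced) {w : W}
    (hw : cs.IsContentMaximal w) : ∃ a, M.Matched a ∧ cs.wordProd a = w := by
  obtain ⟨a, ha, rfl⟩ := cs.exists_isReduced w
  induction a using List.reverseRecOn with
  | nil => exact ⟨[], matched_nil, rfl⟩
  | append_singleton a s ih =>
    obtain ⟨hfb, hcm⟩ := (cs.isContentMaximal_iff ha).1 hw
    have hs := cs.isRightDescent_of_isReduced_append_singleton ha
    have ha' := cs.isReduced_of_append_left ha
    have e : cs.wordProd (a ++ [s]) * cs.simple s = cs.wordProd a := by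
      rw [wordProd_append_singleton]; simp
    have hfb' := hfb.mul_simple cs hM hs
    rw [e] at hfb'
    have h1 := cs.excess_mul_simple_le hM ha hfb
    have h2 := cs.ncard_support_add_le hM ha' hfb'
    rw [List.length_append, List.length_singleton] at hcm
    obtain ⟨b, hb, hbw⟩ := ih ha' ((cs.isContentMaximal_iff ha').2 ⟨hfb', by omega⟩)
    have hba := cs.braidEquiv_of_matched hM hb ha' hbw
    have hma := hb.of_braidEquiv hba
    by_cases hsa : s ∈ a
    -- Adding `s` raises the length but not the support, so equality in `ℓ = # supp + N` requires a
    -- new triple, and this has to contain `α_s`.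
    · have h3 : ∃ T, cs.Contractible (cs.wordProd (a ++ [s])) T ∧ simpleRoot s ∈ T := by
        by_contra! h3
        have h4 := cs.ncard_le_of_forall_notMem hM hfb hs h3
        rw [e] at h4
        rw [cs.support_append_singleton hM ha hsa] at hcm
        omega
      obtain ⟨T, hT, hsT⟩ := h3
      obtain ⟨u, v, x, hsv, hx, h4, h5, rfl⟩ := hT.exists_isReduced_of_mem cs hM hfb hsT
      -- The last `s` of the braid moves to the end of the word. Deleting it leaves a reduced word
      -- of `w s`, equivalent to the matched word `a`.
      have e1 : M.BraidEquiv (u ++ s :: v :: s :: x) (u ++ s :: v :: (x ++ [s])) := by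
        simpa using (braidEquiv_cons_concat hx).append (u ++ [s, v]) []
      have h6 := cs.isReduced_of_braidEquiv e1 h4
      have h7 := (cs.wordProd_eq_of_braidEquiv e1).symm.trans h5
      have q : u ++ s :: v :: (x ++ [s]) = (u ++ s :: v :: x) ++ [s] := by simp
      have h8 : cs.wordProd (u ++ s :: v :: x) = cs.wordProd (a ++ [s]) * cs.simple s := by
        rw [← h7, q, wordProd_append_singleton]; simp
      rw [q] at h6
      have h9 := cs.braidEquiv_of_matched hM hma (cs.isReduced_of_append_left h6)
        (e.symm.trans h8.symm)
      have hm := hma.of_braidEquiv h9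
      have hnc := fun {p t} => cs.not_cross_of_contractible hM hm hsv hx hfb hs h8 hT
        (p := p) (t := t)
      exact ⟨_, hm.append_braid hsv hx (fun t => hnc (.inl rfl)) (fun t => hnc (.inr rfl)), h7⟩
    · exact ⟨_, hma.append_singleton hsa, rfl⟩

/-- The content maximal elements are the elements of the matched words. -/
theorem isContentMaximal_iff_exists_matched (hM : M.IsSimplyLaced) {w : W} :
    cs.IsContentMaximal w ↔ ∃ a, M.Matched a ∧ cs.wordProd a = w := by
  refine ⟨cs.exists_matched_of_isContentMaximal hM, ?_⟩
  rintro ⟨a, ha, rfl⟩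
  exact cs.isContentMaximal_of_matched hM ha

end ContentMaximal

end CoxeterSystem

/-! ### Words over a graph with an added leaf -/

namespace CoxeterMatrix

section Leaf

variable {B : Type*} {M : CoxeterMatrix B}

/-- The letter `k` occurs in the word `a` and crosses none of its neighbours. -/
def Single (M : CoxeterMatrix B) (k : B) (a : List B) : Prop :=
  k ∈ a ∧ ∀ t, M k t = 3 → ¬Cross a k t

/-- The letter `k` crosses one of its neighbours in the word `a`. -/
def Crossed (M : CoxeterMatrix B) (k : B) (a : List B) : Prop := ∃ t, M k t = 3 ∧ Cross a k t

theorem precedes_append_singleton {a : List B} {s p q : B} :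
    Precedes (a ++ [s]) p q ↔ Precedes a p q ∨ (p ∈ a ∧ q = s) := by
  simp [precedes_append, precedes_cons, not_precedes_nil]

theorem cross_append_singleton {a : List B} {s : B} (hs : s ∉ a) {p q : B} :
    Cross (a ++ [s]) p q ↔ Cross a p q := by
  have hmr := @Precedes.mem_right B
  have hml := @Precedes.mem_left B
  simp only [Cross, precedes_append_singleton]
  grind

theorem cross_cons {a : List B} {s : B} (hs : s ∉ a) {p q : B} :
    Cross (s :: a) p q ↔ Cross a p q := by
  have hmr := @Precedes.mem_right B
  have hml := @Precedes.mem_left B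
  simp only [Cross, precedes_cons]
  grind

theorem Cross.mem_left {a : List B} {s t : B} (h : Cross a s t) : s ∈ a := h.1.mem_left

theorem Cross.mem_right {a : List B} {s t : B} (h : Cross a s t) : t ∈ a := h.1.mem_right

theorem Crossed.mem {a : List B} {k : B} (h : M.Crossed k a) : k ∈ a := by
  obtain ⟨t, -, h⟩ := h
  exact h.mem_left

theorem single_iff {a : List B} {k : B} : M.Single k a ↔ k ∈ a ∧ ¬M.Crossed k a := by
  simp [Single, Crossed]

/-- The letter `i` is not in `J`, and its only neighbour in `J` is `j`. -/
structure IsLeaf (M : CoxeterMatrix B) (J : Set B) (i j : B) : Prop where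
  notMem : i ∉ J
  adj : M i j = 3
  eq_of_adj : ∀ x ∈ J, M i x = 3 → x = j

theorem IsLeaf.eq_two (hM : M.IsSimplyLaced) {J : Set B} {i j : B}
    (h : M.IsLeaf J i j) {a : List B}
    (ha : ∀ x ∈ a, x ∈ J) (hj : j ∉ a) : ∀ x ∈ a, M i x = 2 := by
  intro x hx
  refine (hM i x ?_).resolve_right fun h3 => hj (h.eq_of_adj x (ha x hx) h3 ▸ hx)
  rintro rfl
  exact h.notMem (ha _ hx)

variable [DecidableEq B]

/-- A property of words that is invariant under braid equivalence of matched words. -/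
def BraidInvariant (M : CoxeterMatrix B) (Q : List B → Prop) : Prop :=
  ∀ a b, M.Matched a → M.BraidEquiv a b → (Q a ↔ Q b)

theorem braidInvariant_notMem (k : B) : M.BraidInvariant fun a => k ∉ a :=
  fun _ _ _ h => not_congr (h.mem_iff k)

theorem braidInvariant_crossed (k : B) : M.BraidInvariant (M.Crossed k) :=
  fun _ _ ha h => exists_congr fun _ => and_congr_right fun hk => ha.cross_iff_of_braidEquiv h hk

theorem braidInvariant_single (k : B) : M.BraidInvariant (M.Single k) :=
  fun _ _ ha h => and_congr (h.mem_iff k) <| forall_congr' fun _ => forall_congr' fun hk =>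
    not_congr (ha.cross_iff_of_braidEquiv h hk)

theorem braidInvariant_precedes {s t : B} (h : M s t = 3) :
    M.BraidInvariant fun a => Precedes a s t :=
  fun _ _ ha e => ha.precedes_iff_of_braidEquiv e h

theorem Matched.cons {a : List B} (ha : M.Matched a) {s : B} (hs : s ∉ a) :
    M.Matched (s :: a) := by
  refine ⟨fun {p q} h h' => ?_, fun h1 h2 h3 h4 =>
    ha.unique h1 h2 ((cross_cons hs).1 h3) ((cross_cons hs).1 h4), fun {p} h => ?_⟩
  · have h1 := (cross_cons hs).1 h'
    have h2 := ha.count_add_count h h1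
    have h3 : s ≠ p := fun h => hs (h ▸ h1.mem_left)
    have h4 : s ≠ q := fun h => hs (h ▸ h1.mem_right)
    rwa [List.count_cons_of_ne h3, List.count_cons_of_ne h4]
  · have h3 : s ≠ p := by
      rintro rfl
      simp [List.count_eq_zero.2 hs] at h
    rw [List.count_cons_of_ne h3] at h
    obtain ⟨t, h1, h2⟩ := ha.exists_cross h
    exact ⟨t, h1, (cross_cons hs).2 h2⟩

theorem precedes_filter {a : List B} {i p q : B} (hp : p ≠ i) (hq : q ≠ i) :
    Precedes (a.filter (· ≠ i)) p q ↔ Precedes a p q := by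
  refine ⟨fun h => h.trans List.filter_sublist, fun h => ?_⟩
  have := List.Sublist.filter (· ≠ i) h
  simpa [Precedes, hp, hq] using this

/-- Deleting `i` could only leave its partner repeated with nothing to cross; the condition on
counts excludes this. -/
theorem Matched.filter {a : List B} (ha : M.Matched a) {i : B}
    (hi : ∀ t, M i t = 3 → Cross a i t → a.count t ≤ 1) : M.Matched (a.filter (· ≠ i)) := by
  have hne : ∀ {p q}, Cross (a.filter (· ≠ i)) p q → p ≠ i := by
    intro p q h
    simpa using List.of_mem_filter h.mem_left
  have hc : ∀ {p q}, Cross (a.filter (· ≠ i)) p q → Cross a p q := fun h =>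
    (and_congr (precedes_filter (hne h) (hne h.symm)) (precedes_filter (hne h.symm) (hne h))).1 h
  refine ⟨fun {p q} h h' => ?_, fun h1 h2 h3 h4 => ha.unique h1 h2 (hc h3) (hc h4),
    fun {p} h => ?_⟩
  · rw [List.count_filter (by simpa using hne h'), List.count_filter (by simpa using hne h'.symm)]
    exact ha.count_add_count h (hc h')
  · have hp : p ≠ i := by
      have : p ∈ a.filter (· ≠ i) := by
        rw [← List.count_pos_iff]
        omega
      simpa using List.of_mem_filter this
    rw [List.count_filter (by simpa using hp)] at h
    obtain ⟨t, h1, h2⟩ := ha.exists_cross h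
    have ht : t ≠ i := by
      rintro rfl
      have := hi p (by rw [M.symmetric, h1]) h2.symm
      omega
    exact ⟨t, h1, (precedes_filter hp ht).2 h2.1, (precedes_filter ht hp).2 h2.2⟩

theorem filter_ne_eq_self {a : List B} {i : B} (h : i ∉ a) : a.filter (· ≠ i) = a := by
  rw [List.filter_eq_self]
  intro x hx
  have : x ≠ i := fun e => h (e ▸ hx)
  simpa using this

variable {J : Set B} {i j : B}

/-- The letter `i` interacts only with `j`. If they cross, gather them into `i j i`, move the last
`i` to the end and delete both. Otherwise `i` occurs once and `j` lies on one side of it only, so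
`i` slides to the front or to the back. When `j` is absent both ends give the same element, and
requiring `j ∈ a` in the second case makes the choice unique. -/
theorem IsLeaf.exists_decomposition (hM : M.IsSimplyLaced) (h : M.IsLeaf J i j) {c : List B}
    (hc : M.Matched c) (hcJ : ∀ x ∈ c, x ∈ insert i J) (hi : i ∈ c) :
    ∃ a, M.Matched a ∧ (∀ x ∈ a, x ∈ J) ∧ (M.BraidEquiv c (i :: a) ∨
      (j ∈ a ∧ M.BraidEquiv c (a ++ [i])) ∨
      (M.Single j a ∧ ∃ u v, a = u ++ j :: v ∧ M.BraidEquiv c (u ++ i :: j :: (v ++ [i])))) := by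
  have hJ : ∀ {a : List B}, i ∉ a → (∀ x ∈ a, x ∈ insert i J) → ∀ x ∈ a, x ∈ J := by
    intro a hia ha x hx
    exact (ha x hx).resolve_left fun e => hia (e ▸ hx)
  have hij : i ≠ j := ne_of_three h.adj
  by_cases hx : M.Crossed i c
  · obtain ⟨t, hit, hcr⟩ := hx
    have htJ : t ∈ J := (hcJ t hcr.mem_right).resolve_left (ne_of_three hit).symm
    obtain rfl := h.eq_of_adj t htJ hit
    obtain ⟨u, v, e⟩ := hc.exists_braid hM hit hcr
    have hb := hc.of_braidEquiv e
    obtain ⟨h1, h2, h3, h4⟩ := hb.notMem_of_braid hit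
    have hbJ : ∀ x ∈ u ++ i :: t :: i :: v, x ∈ insert i J := fun x hx =>
      hcJ x ((e.mem_iff x).2 hx)
    have hu := hJ h1 fun x hx => hbJ x (by simp [hx])
    have hv := hJ h2 fun x hx => hbJ x (by simp [hx])
    have e1 : M.BraidEquiv (u ++ i :: t :: i :: v) (u ++ i :: t :: (v ++ [i])) := by
      simpa using (braidEquiv_cons_concat (h.eq_two hM hv h4)).append (u ++ [i, t]) []
    have hd := hb.of_braidEquiv e1
    have hcr' : Cross (u ++ i :: t :: (v ++ [i])) i t := by
      simp [Cross, precedes_append, precedes_cons]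
    have hcount : (u ++ i :: t :: (v ++ [i])).count t = 1 := by
      simp [List.count_eq_zero.2 h3, List.count_eq_zero.2 h4, hij]
    have hf : (u ++ i :: t :: (v ++ [i])).filter (· ≠ i) = u ++ t :: v := by
      have q1 := filter_ne_eq_self h1
      have q2 := filter_ne_eq_self h2
      simp only [List.filter_append, List.filter_cons, q1, q2]
      simp [hij.symm]
    have hm := hd.filter (i := i) fun t' ht' hct' => by
      rw [hd.unique ht' hit hct' hcr', hcount]
    rw [hf] at hm
    refine ⟨_, hm, ?_, .inr (.inr ⟨⟨by simp, fun z hz hcz => ?_⟩, u, v, rfl, e.trans e1⟩)⟩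
    · intro x hx
      simp only [List.mem_append, List.mem_cons] at hx
      rcases hx with hx | rfl | hx
      · exact hu x hx
      · exact htJ
      · exact hv x hx
    · have h5 := hm.count_add_count hz hcz
      have hti : M t i = 3 := by rw [M.symmetric, hit]
      -- A letter `z` that crosses `j` after the deletion already crossed it before, when `j`
      -- crossed `i`; uniqueness would give `z = i`, which has been deleted.
      have hzi : z ≠ i := by
        rintro rfl
        have := hcz.mem_right
        simp only [List.mem_append, List.mem_cons, h1, h2, hij] at this
        tauto
      rw [← hf] at hcz
      exact hzi (hd.unique hz hti ⟨(precedes_filter hij.symm hzi).1 hcz.1,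
        (precedes_filter hzi hij.symm).1 hcz.2⟩ hcr'.symm)
  · have hnc : ∀ t, M i t = 3 → ¬Cross c i t := fun t h1 h2 => hx ⟨t, h1, h2⟩
    obtain ⟨x, y, rfl⟩ := List.append_of_mem hi
    obtain ⟨h1, h2⟩ := hc.notMem_of_not_cross hnc
    have hm := hc.filter (i := i) fun t h3 h4 => (hnc t h3 h4).elim
    have hf : (x ++ i :: y).filter (· ≠ i) = x ++ y := by
      have q1 := filter_ne_eq_self h1
      have q2 := filter_ne_eq_self h2
      simp only [List.filter_append, List.filter_cons, q1, q2]
      simp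
    rw [hf] at hm
    have hx' := hJ h1 fun z hz => hcJ z (by simp [hz])
    have hy' := hJ h2 fun z hz => hcJ z (by simp [hz])
    refine ⟨_, hm, fun z hz => (List.mem_append.1 hz).elim (hx' z) (hy' z), ?_⟩
    by_cases hjx : j ∈ x
    · have hjy : j ∉ y := fun hjy => hnc j h.adj
        ⟨by simp [precedes_append, precedes_cons, hjy], by simp [precedes_append, hjx]⟩
      refine .inr (.inl ⟨by simp [hjx], ?_⟩)
      simpa using (braidEquiv_cons_concat (h.eq_two hM hy' hjy)).append x []
    · refine .inl ?_
      simpa using ((braidEquiv_cons_concat (h.eq_two hM hx' hjx)).symm).append [] y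

/-- The converse of the third case above: since `j` occurs once, the first `i` commutes with `u` and
can be carried up to `j`, after which `Matched.append_braid` applies. -/
theorem IsLeaf.matched_braid (hM : M.IsSimplyLaced) (h : M.IsLeaf J i j) {u v : List B}
    (ha : M.Matched (u ++ j :: v)) (haJ : ∀ x ∈ u ++ j :: v, x ∈ J)
    (hj : M.Single j (u ++ j :: v)) :
    M.Matched (u ++ i :: j :: (v ++ [i])) ∧
      M.BraidEquiv (i :: (u ++ j :: v) ++ [i]) (u ++ i :: j :: (v ++ [i])) := by
  have hi : i ∉ u ++ j :: v := fun hi => h.notMem (haJ i hi)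
  obtain ⟨hju, hjv⟩ := ha.notMem_of_not_cross hj.2
  have hu := h.eq_two hM (a := u) (fun x hx => haJ x (by simp [hx])) hju
  have hv := h.eq_two hM (a := v) (fun x hx => haJ x (by simp [hx])) hjv
  have e : M.BraidEquiv (i :: (u ++ j :: v)) (u ++ i :: j :: v) := by
    simpa using (braidEquiv_cons_concat hu).append [] (j :: v)
  have hm := ha.cons hi
  have hc : ∀ t s, M s t = 3 → (Cross (u ++ i :: j :: v) s t ↔ Cross (u ++ j :: v) s t) :=
    fun t s hst => ((hm.cross_iff_of_braidEquiv e hst).symm.trans (cross_cons hi))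
  refine ⟨(hm.of_braidEquiv e).append_braid h.adj hv (fun t ht hcr => hi ?_) (fun t ht hcr => ?_),
    by simpa using e.append [] [i]⟩
  · exact ((hc t i ht).1 hcr).mem_left
  · exact hj.2 t ht ((hc t j ht).1 hcr)

end Leaf

end CoxeterMatrix

/-! ### Counting by the states of a vertex -/

namespace CoxeterSystem

open CoxeterMatrix

section LeafRecursion

variable {B : Type*} {W : Type*} [Group W] {M : CoxeterMatrix B} (cs : CoxeterSystem M W)
  [DecidableEq B]

/-- The elements of the matched words with letters in `J` that satisfy `Q`. -/
def matchedElements (J : Set B) (Q : List B → Prop) : Set W :=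
  {w | ∃ a, M.Matched a ∧ (∀ x ∈ a, x ∈ J) ∧ Q a ∧ cs.wordProd a = w}

variable {J : Set B} {i j : B}

theorem matchedElements_congr {Q Q' : List B → Prop}
    (h : ∀ a, M.Matched a → (∀ x ∈ a, x ∈ J) → (Q a ↔ Q' a)) :
    cs.matchedElements J Q = cs.matchedElements J Q' := by
  ext w
  refine exists_congr fun a => and_congr_right fun h1 => and_congr_right fun h2 =>
    and_congr_left fun _ => h a h1 h2

theorem matchedElements_eq_empty {Q : List B → Prop}
    (h : ∀ a, M.Matched a → (∀ x ∈ a, x ∈ J) → ¬Q a) : cs.matchedElements J Q = ∅ := by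
  rw [Set.eq_empty_iff_forall_notMem]
  rintro w ⟨a, h1, h2, h3, -⟩
  exact h a h1 h2 h3

theorem matchedElements_disjoint (hM : M.IsSimplyLaced) {Q Q' : List B → Prop}
    (hQ : M.BraidInvariant Q) (h : ∀ a, Q a → ¬Q' a) :
    Disjoint (cs.matchedElements J Q) (cs.matchedElements J Q') := by
  rw [Set.disjoint_left]
  rintro w ⟨a, h1, h2, h3, rfl⟩ ⟨b, h4, h5, h6, h7⟩
  have e := cs.braidEquiv_of_matched hM h1 (cs.isReduced_of_matched hM h4) h7.symm
  exact h b ((hQ a b h1 e).1 h3) h6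

/-- The effect of adding a leaf on the set of matched elements. -/
theorem encard_matchedElements_insert (hM : M.IsSimplyLaced) (h : M.IsLeaf J i j)
    {Q : List B → Prop} (hQ : M.BraidInvariant Q) :
    (cs.matchedElements (insert i J) Q).encard =
      (cs.matchedElements J Q).encard + (cs.matchedElements J fun a => Q (i :: a)).encard +
      (cs.matchedElements J fun a => j ∈ a ∧ Q (a ++ [i])).encard +
      (cs.matchedElements J fun a => M.Single j a ∧
        ∃ u v, a = u ++ j :: v ∧ Q (u ++ i :: j :: (v ++ [i]))).encard := by
  have hij : i ≠ j := ne_of_three h.adj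
  have hji : M j i = 3 := by rw [M.symmetric, h.adj]
  have hnotMem : ∀ {a : List B}, (∀ x ∈ a, x ∈ J) → i ∉ a := fun ha hi => h.notMem (ha i hi)
  have hsub : ∀ {a : List B}, (∀ x ∈ a, x ∈ J) → ∀ x ∈ a, x ∈ insert i J :=
    fun ha x hx => Set.mem_insert_of_mem _ (ha x hx)
  have hcross : ∀ u v : List B, Cross (u ++ i :: j :: (v ++ [i])) i j := fun u v => by
    simp [Cross, precedes_append, precedes_cons]
  -- The four sets consist of `w`, `sᵢ w`, `w sᵢ` and `sᵢ w sᵢ`. They are told apart by braid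
  -- invariants: whether `i` occurs, whether it crosses `j`, and whether `j` precedes it.
  set S0 := cs.matchedElements J Q with hS0
  set S1 := (fun w => cs.simple i * w) '' cs.matchedElements J (fun a => Q (i :: a)) with hS1
  set S2 := (fun w => w * cs.simple i) '' cs.matchedElements J (fun a => j ∈ a ∧ Q (a ++ [i]))
    with hS2
  set S3 := (fun w => cs.simple i * w * cs.simple i) '' cs.matchedElements J (fun a =>
    M.Single j a ∧ ∃ u v, a = u ++ j :: v ∧ Q (u ++ i :: j :: (v ++ [i]))) with hS3
  have h0 : S0 ⊆ cs.matchedElements (insert i J) fun c => i ∉ c ∧ Q c := by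
    rintro w ⟨a, h1, h2, h3, rfl⟩
    exact ⟨a, h1, hsub h2, ⟨hnotMem h2, h3⟩, rfl⟩
  have h1 : S1 ⊆ cs.matchedElements (insert i J) fun c =>
      (i ∈ c ∧ ¬Cross c i j ∧ ¬Precedes c j i) ∧ Q c := by
    rintro _ ⟨w, ⟨a, h1, h2, h3, rfl⟩, rfl⟩
    have hia := hnotMem h2
    refine ⟨i :: a, h1.cons hia, fun x hx => ?_, ⟨⟨by simp, ?_, ?_⟩, h3⟩, cs.wordProd_cons i a⟩
    · rcases List.mem_cons.1 hx with rfl | hx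
      · exact Set.mem_insert _ _
      · exact hsub h2 x hx
    · rw [cross_cons hia]
      exact fun h => hia h.mem_left
    · rw [precedes_cons]
      rintro (⟨h4, -⟩ | h4)
      · exact hij h4.symm
      · exact hia h4.mem_right
  have h2 : S2 ⊆ cs.matchedElements (insert i J) fun c =>
      (i ∈ c ∧ ¬Cross c i j ∧ Precedes c j i) ∧ Q c := by
    rintro _ ⟨w, ⟨a, h1, h2, ⟨hja, h3⟩, rfl⟩, rfl⟩
    have hia := hnotMem h2
    refine ⟨a ++ [i], h1.append_singleton hia, fun x hx => ?_, ⟨⟨by simp, ?_, ?_⟩, h3⟩,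
      cs.wordProd_append_singleton a i⟩
    · rcases List.mem_append.1 hx with hx | hx
      · exact hsub h2 x hx
      · exact .inl (by simpa using hx)
    · rw [cross_append_singleton hia]
      exact fun h => hia h.mem_left
    · rw [precedes_append_singleton]
      exact .inr ⟨hja, rfl⟩
  have h3 : S3 ⊆ cs.matchedElements (insert i J) fun c => (i ∈ c ∧ Cross c i j) ∧ Q c := by
    rintro _ ⟨w, ⟨a, h1, h2, ⟨hja, u, v, rfl, h3⟩, rfl⟩, rfl⟩
    obtain ⟨hm, e⟩ := h.matched_braid hM h1 h2 hja
    refine ⟨_, hm, fun x hx => ?_, ⟨⟨by simp, hcross u v⟩, h3⟩, ?_⟩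
    · rw [← e.mem_iff x] at hx
      simp only [List.cons_append, List.append_assoc, List.mem_cons, List.mem_append,
        List.not_mem_nil, or_false] at hx
      have := h2 x
      simp only [List.mem_append, List.mem_cons] at this
      rw [Set.mem_insert_iff]
      tauto
    · rw [← cs.wordProd_eq_of_braidEquiv e, wordProd_append_singleton,
        wordProd_cons]
  have hunion : cs.matchedElements (insert i J) Q = S0 ∪ S1 ∪ S2 ∪ S3 := by
    refine Set.Subset.antisymm ?_ ?_
    · rintro w ⟨c, hc, hcJ, hQc, rfl⟩
      by_cases hi : i ∈ c
      · obtain ⟨a, ha, haJ, h4⟩ := h.exists_decomposition hM hc hcJ hi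
        rcases h4 with e | ⟨hja, e⟩ | ⟨hja, u, v, rfl, e⟩
        · refine .inl (.inl (.inr ⟨_, ⟨a, ha, haJ, (hQ _ _ hc e).1 hQc, rfl⟩, ?_⟩))
          rw [cs.wordProd_eq_of_braidEquiv e, wordProd_cons]
        · refine .inl (.inr ⟨_, ⟨a, ha, haJ, ⟨hja, (hQ _ _ hc e).1 hQc⟩, rfl⟩, ?_⟩)
          rw [cs.wordProd_eq_of_braidEquiv e, wordProd_append_singleton]
        · refine .inr ⟨_, ⟨_, ha, haJ, ⟨hja, u, v, rfl, (hQ _ _ hc e).1 hQc⟩, rfl⟩, ?_⟩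
          have e' := (h.matched_braid hM ha haJ hja).2
          rw [cs.wordProd_eq_of_braidEquiv e, ← cs.wordProd_eq_of_braidEquiv e',
            wordProd_append_singleton, wordProd_cons]
      · refine .inl (.inl (.inl ⟨c, hc, fun x hx => ?_, hQc, rfl⟩))
        exact (hcJ x hx).resolve_left fun e => hi (e ▸ hx)
    · rintro w (((hw | hw) | hw) | hw)
      · obtain ⟨c, hc, hcJ, ⟨-, hQc⟩, rfl⟩ := h0 hw
        exact ⟨c, hc, hcJ, hQc, rfl⟩
      · obtain ⟨c, hc, hcJ, ⟨-, hQc⟩, rfl⟩ := h1 hw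
        exact ⟨c, hc, hcJ, hQc, rfl⟩
      · obtain ⟨c, hc, hcJ, ⟨-, hQc⟩, rfl⟩ := h2 hw
        exact ⟨c, hc, hcJ, hQc, rfl⟩
      · obtain ⟨c, hc, hcJ, ⟨-, hQc⟩, rfl⟩ := h3 hw
        exact ⟨c, hc, hcJ, hQc, rfl⟩
  have i0 : M.BraidInvariant fun c => i ∉ c ∧ Q c := fun a b ha e =>
    and_congr (braidInvariant_notMem i a b ha e) (hQ a b ha e)
  have ic : M.BraidInvariant fun c => Cross c i j := fun a b ha e =>
    ha.cross_iff_of_braidEquiv e h.adj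
  have i1 : M.BraidInvariant fun c => (i ∈ c ∧ ¬Cross c i j ∧ ¬Precedes c j i) ∧ Q c :=
    fun a b ha e => and_congr (and_congr (e.mem_iff i) (and_congr (not_congr (ic a b ha e))
      (not_congr (braidInvariant_precedes hji a b ha e)))) (hQ a b ha e)
  have i2 : M.BraidInvariant fun c => (i ∈ c ∧ ¬Cross c i j ∧ Precedes c j i) ∧ Q c :=
    fun a b ha e => and_congr (and_congr (e.mem_iff i) (and_congr (not_congr (ic a b ha e))
      (braidInvariant_precedes hji a b ha e))) (hQ a b ha e)
  have d01 : Disjoint S0 S1 := (cs.matchedElements_disjoint hM i0 (by tauto)).mono h0 h1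
  have d02 : Disjoint S0 S2 := (cs.matchedElements_disjoint hM i0 (by tauto)).mono h0 h2
  have d03 : Disjoint S0 S3 := (cs.matchedElements_disjoint hM i0 (by tauto)).mono h0 h3
  have d12 : Disjoint S1 S2 := (cs.matchedElements_disjoint hM i1 (by tauto)).mono h1 h2
  have d13 : Disjoint S1 S3 := (cs.matchedElements_disjoint hM i1 (by tauto)).mono h1 h3
  have d23 : Disjoint S2 S3 := (cs.matchedElements_disjoint hM i2 (by tauto)).mono h2 h3
  have hinj : Function.Injective fun w => cs.simple i * w * cs.simple i :=
    (mul_left_injective _).comp (mul_right_injective _)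
  rw [hunion, Set.encard_union_eq (by simp [d03, d13, d23]),
    Set.encard_union_eq (by simp [d02, d12]), Set.encard_union_eq d01, hS1, hS2, hS3,
    Function.Injective.encard_image (mul_right_injective _),
    Function.Injective.encard_image (mul_left_injective _),
    hinj.encard_image]

/-- The numbers of matched elements over `J` in which the letter `k` is absent, occurs without
crossing a neighbour, and crosses a neighbour, respectively. -/
structure HasStateCount (J : Set B) (k : B) (a u m : ℕ) : Prop where
  absent : (cs.matchedElements J fun c => k ∉ c).encard = a
  single : (cs.matchedElements J (M.Single k)).encard = u
  crossed : (cs.matchedElements J (M.Crossed k)).encard = m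

variable {a u m : ℕ}

theorem HasStateCount.encard_mem (hM : M.IsSimplyLaced) {k : B}
    (h : cs.HasStateCount J k a u m) :
    (cs.matchedElements J fun c => k ∈ c).encard = (u + m : ℕ) := by
  have e : (cs.matchedElements J fun c => k ∈ c) =
      cs.matchedElements J (M.Single k) ∪ cs.matchedElements J (M.Crossed k) := by
    ext w
    constructor
    · rintro ⟨c, h1, h2, h3, rfl⟩
      by_cases hc : M.Crossed k c
      · exact .inr ⟨c, h1, h2, hc, rfl⟩
      · exact .inl ⟨c, h1, h2, single_iff.2 ⟨h3, hc⟩, rfl⟩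
    · rintro (⟨c, h1, h2, h3, rfl⟩ | ⟨c, h1, h2, h3, rfl⟩)
      · exact ⟨c, h1, h2, h3.1, rfl⟩
      · exact ⟨c, h1, h2, h3.mem, rfl⟩
  rw [e, Set.encard_union_eq, h.single, h.crossed]
  · simp
  · exact cs.matchedElements_disjoint hM (braidInvariant_single k) fun c h1 => (single_iff.1 h1).2

theorem HasStateCount.encard_univ (hM : M.IsSimplyLaced) {k : B}
    (h : cs.HasStateCount J k a u m) :
    (cs.matchedElements J fun _ => True).encard = (a + u + m : ℕ) := by
  have e : (cs.matchedElements J fun _ => True) =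
      (cs.matchedElements J fun c => k ∉ c) ∪ (cs.matchedElements J fun c => k ∈ c) := by
    ext w
    constructor
    · rintro ⟨c, h1, h2, -, rfl⟩
      by_cases hc : k ∈ c
      · exact .inr ⟨c, h1, h2, hc, rfl⟩
      · exact .inl ⟨c, h1, h2, hc, rfl⟩
    · rintro (⟨c, h1, h2, h3, rfl⟩ | ⟨c, h1, h2, h3, rfl⟩) <;> exact ⟨c, h1, h2, trivial, rfl⟩
  rw [e, Set.encard_union_eq, h.absent, h.encard_mem cs hM, add_assoc]
  · simp
  · exact cs.matchedElements_disjoint hM (braidInvariant_notMem k) fun c h1 => h1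

/-- The state counts of a leaf. -/
theorem HasStateCount.insert_leaf (hM : M.IsSimplyLaced) (hl : M.IsLeaf J i j)
    (h : cs.HasStateCount J j a u m) :
    cs.HasStateCount (insert i J) i (a + u + m) (a + 2 * u + 2 * m) u := by
  have hnotMem : ∀ {a : List B}, (∀ x ∈ a, x ∈ J) → i ∉ a := fun ha hi => hl.notMem (ha i hi)
  have hcross : ∀ u v : List B, M.Crossed i (u ++ i :: j :: (v ++ [i])) := fun u v =>
    ⟨j, hl.adj, by simp [Cross, precedes_append, precedes_cons]⟩
  have c1 : ∀ {a : List B}, (∀ x ∈ a, x ∈ J) → ¬M.Crossed i (i :: a) := by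
    rintro a ha ⟨t, -, hc⟩
    exact hnotMem ha ((cross_cons (hnotMem ha)).1 hc).mem_left
  have c2 : ∀ {a : List B}, (∀ x ∈ a, x ∈ J) → ¬M.Crossed i (a ++ [i]) := by
    rintro a ha ⟨t, -, hc⟩
    exact hnotMem ha ((cross_append_singleton (hnotMem ha)).1 hc).mem_left
  -- For each state of `i`: it is absent in every `w`; it is single in every `sᵢ w` and in `w sᵢ`
  -- for `j` in `w`, giving `(a + u + m) + (u + m)`; it is crossed in `sᵢ w sᵢ`, which needs `j`
  -- single in `w`.
  refine ⟨?_, ?_, ?_⟩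
  · rw [cs.encard_matchedElements_insert hM hl (braidInvariant_notMem i),
      cs.matchedElements_congr (J := J) (Q' := fun _ => True) fun c _ h2 => by simp [hnotMem h2],
      cs.matchedElements_eq_empty (Q := fun c => i ∉ i :: c) (by simp),
      cs.matchedElements_eq_empty (Q := fun c => j ∈ c ∧ i ∉ c ++ [i]) (by simp),
      cs.matchedElements_eq_empty (Q := fun c => M.Single j c ∧
        ∃ u v, c = u ++ j :: v ∧ i ∉ u ++ i :: j :: (v ++ [i])) (by simp),
      h.encard_univ cs hM]
    simp
  · rw [cs.encard_matchedElements_insert hM hl (braidInvariant_single i),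
      cs.matchedElements_eq_empty (Q := M.Single i) (fun c _ h2 h3 => hnotMem h2 h3.1),
      cs.matchedElements_congr (Q := fun c => M.Single i (i :: c)) (Q' := fun _ => True)
        fun c _ h2 => by simp [single_iff, c1 h2],
      cs.matchedElements_congr (Q := fun c => j ∈ c ∧ M.Single i (c ++ [i]))
        (Q' := fun c => j ∈ c) fun c _ h2 => by simp [single_iff, c2 h2],
      cs.matchedElements_eq_empty (Q := fun c => M.Single j c ∧
        ∃ u v, c = u ++ j :: v ∧ M.Single i (u ++ i :: j :: (v ++ [i])))
        (by simp [single_iff, hcross]),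
      h.encard_univ cs hM, h.encard_mem cs hM]
    simp only [Set.encard_empty, zero_add, add_zero]
    norm_cast
    ring
  · rw [cs.encard_matchedElements_insert hM hl (braidInvariant_crossed i),
      cs.matchedElements_eq_empty (Q := M.Crossed i) (fun c _ h2 h3 => hnotMem h2 h3.mem),
      cs.matchedElements_eq_empty (Q := fun c => M.Crossed i (i :: c)) (fun c _ h2 => c1 h2),
      cs.matchedElements_eq_empty (Q := fun c => j ∈ c ∧ M.Crossed i (c ++ [i]))
        (fun c _ h2 h3 => c2 h2 h3.2),
      cs.matchedElements_congr (Q := fun c => M.Single j c ∧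
        ∃ u v, c = u ++ j :: v ∧ M.Crossed i (u ++ i :: j :: (v ++ [i])))
        (Q' := M.Single j) fun c _ h2 => by
          simp only [hcross, and_true, and_iff_left_iff_imp]
          exact fun h3 => List.append_of_mem h3.1,
      h.single]
    simp

/-- The effect of a leaf on the state counts of its neighbour. -/
theorem HasStateCount.insert_leaf_of_neighbour (hM : M.IsSimplyLaced) (hl : M.IsLeaf J i j)
    (h : cs.HasStateCount J j a u m) :
    cs.HasStateCount (insert i J) j (2 * a) (3 * u) (3 * m + u) := by
  have hij : i ≠ j := ne_of_three hl.adj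
  have hji : M j i = 3 := by rw [M.symmetric, hl.adj]
  have hnotMem : ∀ {a : List B}, (∀ x ∈ a, x ∈ J) → i ∉ a := fun ha hi => hl.notMem (ha i hi)
  have hcross : ∀ u v : List B, M.Crossed j (u ++ i :: j :: (v ++ [i])) := fun u v =>
    ⟨i, hji, by simp [Cross, precedes_append, precedes_cons]⟩
  have c1 : ∀ {a : List B}, (∀ x ∈ a, x ∈ J) → (M.Crossed j (i :: a) ↔ M.Crossed j a) :=
    fun ha => exists_congr fun t => and_congr_right fun _ => cross_cons (hnotMem ha)
  have c2 : ∀ {a : List B}, (∀ x ∈ a, x ∈ J) → (M.Crossed j (a ++ [i]) ↔ M.Crossed j a) :=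
    fun ha => exists_congr fun t => and_congr_right fun _ => cross_append_singleton (hnotMem ha)
  -- For each state of `j`: if it is absent, only `w` and `sᵢ w` count as different; if it is
  -- present, `w`, `sᵢ w` and `w sᵢ` all keep its state; and `sᵢ w sᵢ` turns single into crossed.
  refine ⟨?_, ?_, ?_⟩
  · rw [cs.encard_matchedElements_insert hM hl (braidInvariant_notMem j),
      cs.matchedElements_congr (Q := fun c => j ∉ i :: c) (Q' := fun c => j ∉ c)
        fun c _ _ => by simp [hij.symm],
      cs.matchedElements_eq_empty (Q := fun c => j ∈ c ∧ j ∉ c ++ [i])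
        (by simp +contextual),
      cs.matchedElements_eq_empty (Q := fun c => M.Single j c ∧
        ∃ u v, c = u ++ j :: v ∧ j ∉ u ++ i :: j :: (v ++ [i])) (by simp),
      h.absent]
    simp only [Set.encard_empty, add_zero]
    norm_cast
    ring
  · rw [cs.encard_matchedElements_insert hM hl (braidInvariant_single j),
      cs.matchedElements_congr (Q := fun c => M.Single j (i :: c)) (Q' := M.Single j)
        fun c _ h2 => by simp [single_iff, c1 h2, hij.symm],
      cs.matchedElements_congr (Q := fun c => j ∈ c ∧ M.Single j (c ++ [i]))
        (Q' := M.Single j) fun c _ h2 => by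
          simp only [single_iff, c2 h2, List.mem_append]
          tauto,
      cs.matchedElements_eq_empty (Q := fun c => M.Single j c ∧
        ∃ u v, c = u ++ j :: v ∧ M.Single j (u ++ i :: j :: (v ++ [i])))
        (by simp [single_iff, hcross]),
      h.single]
    simp only [Set.encard_empty, add_zero]
    norm_cast
    ring
  · rw [cs.encard_matchedElements_insert hM hl (braidInvariant_crossed j),
      cs.matchedElements_congr (Q := fun c => M.Crossed j (i :: c)) (Q' := M.Crossed j)
        fun c _ h2 => c1 h2,
      cs.matchedElements_congr (Q := fun c => j ∈ c ∧ M.Crossed j (c ++ [i]))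
        (Q' := M.Crossed j) fun c _ h2 => by
          rw [c2 h2]
          exact and_iff_right_of_imp fun h3 => h3.mem,
      cs.matchedElements_congr (Q := fun c => M.Single j c ∧
        ∃ u v, c = u ++ j :: v ∧ M.Crossed j (u ++ i :: j :: (v ++ [i])))
        (Q' := M.Single j) fun c _ h2 => by
          simp only [hcross, and_true, and_iff_left_iff_imp]
          exact fun h3 => List.append_of_mem h3.1,
      h.single, h.crossed]
    norm_cast
    ring

theorem hasStateCount_singleton (i : B) : cs.HasStateCount {i} i 1 1 0 := by
  have hc : ∀ c : List B, (∀ x ∈ c, x ∈ ({i} : Set B)) → ¬M.Crossed i c := by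
    rintro c hc ⟨t, ht, h⟩
    exact ne_of_three ht (hc t h.mem_right).symm
  have hm : ∀ c : List B, M.Matched c → (∀ x ∈ c, x ∈ ({i} : Set B)) → i ∈ c → c = [i] := by
    intro c h1 h2 h3
    have h4 := List.eq_replicate_of_mem (a := i) (l := c) h2
    have h5 : ¬2 ≤ c.count i := fun h => hc c h2 (h1.exists_cross h)
    have h6 := List.count_pos_iff.2 h3
    have h7 : c.count i = c.length := by
      rw [h4]
      simp
    rw [h4, show c.length = 1 by omega]
    rfl
  refine ⟨?_, ?_, ?_⟩
  · have e : (cs.matchedElements {i} fun c => i ∉ c) = {1} := by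
      ext w
      constructor
      · rintro ⟨c, -, h1, h2, rfl⟩
        have : c = [] := List.eq_nil_iff_forall_not_mem.2 fun x hx => h2 (h1 x hx ▸ hx)
        simp [this]
      · rintro rfl
        exact ⟨[], matched_nil, by simp, by simp, by simp⟩
    simp [e]
  · have e : cs.matchedElements {i} (M.Single i) = {cs.simple i} := by
      ext w
      constructor
      · rintro ⟨c, h1, h2, h3, rfl⟩
        simp [hm c h1 h2 h3.1]
      · rintro rfl
        exact ⟨[i], matched_nil.cons (by simp), by simp, single_iff.2 ⟨by simp, hc _ (by simp)⟩,
          by simp⟩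
    simp [e]
  · rw [cs.matchedElements_eq_empty fun c _ h2 => hc c h2]
    simp

end LeafRecursion

end CoxeterSystem

/-! ### The graphs of types A, D and E -/

open CoxeterMatrix CoxeterSystem

/-- The state counts of the end node of a path with `k + 1` nodes. -/
def pathCount : ℕ → ℕ × ℕ × ℕ
  | 0 => (1, 1, 0)
  | k + 1 =>
    let p := pathCount k
    (p.1 + p.2.1 + p.2.2, p.1 + 2 * p.2.1 + 2 * p.2.2, p.2.1)

/-- Linear combinations of the path counts satisfy a linear recurrence of order three. -/
theorem pathCount_recurrence (α β γ k : ℕ) :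
    let f := fun k => α * (pathCount k).1 + β * (pathCount k).2.1 + γ * (pathCount k).2.2
    f (k + 3) + f k = 3 * f (k + 2) + f (k + 1) := by
  -- This is the Cayley–Hamilton relation of the step matrix, whose characteristic polynomial is `x³
  -- - 3x² - x + 1`.
  simp only [pathCount]
  ring

namespace CoxeterMatrix

theorem finite_contentMaximalSet_of_hasStateCount {B : Type*} [DecidableEq B]
    {M : CoxeterMatrix B} (hM : M.IsSimplyLaced) {k : B} {a u m : ℕ}
    (h : M.toCoxeterSystem.HasStateCount Set.univ k a u m) :
    M.contentMaximalSet.Finite ∧ M.numContentMaximal = a + u + m := by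
  have e : M.contentMaximalSet =
      M.toCoxeterSystem.matchedElements Set.univ fun _ => True := by
    ext w
    simp [contentMaximalSet, M.toCoxeterSystem.isContentMaximal_iff_exists_matched hM,
      matchedElements]
  have h1 := h.encard_univ _ hM
  rw [← e] at h1
  exact ⟨Set.finite_of_encard_eq_coe h1, by rw [numContentMaximal, Set.ncard, h1]; rfl⟩

variable {n : ℕ} {M : CoxeterMatrix (Fin n)}

/-- The path is built downwards from the vertex `n - 1`, each new vertex being a leaf. The bound `c`
marks where the graph starts to be a path: `0`, `2` and `3` in types `A`, `D` and `E`. -/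
theorem hasStateCount_path (hM : M.IsSimplyLaced) {c : ℕ}
    (hc : ∀ x y : Fin n, c ≤ x → x < y → (M x y = 3 ↔ (x : ℕ) + 1 = y)) (k : ℕ) (v : Fin n)
    (hv : (v : ℕ) + k + 1 = n) (hcv : c ≤ v) :
    M.toCoxeterSystem.HasStateCount {x | v ≤ x} v (pathCount k).1 (pathCount k).2.1
      (pathCount k).2.2 := by
  induction k generalizing v with
  | zero =>
    have e : {x | v ≤ x} = {v} := by
      ext x
      simp only [Set.mem_ofPred_eq, Set.mem_singleton_iff, Fin.le_def, Fin.ext_iff]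
      have := x.2
      omega
    rw [e]
    exact M.toCoxeterSystem.hasStateCount_singleton v
  | succ k ih =>
    let v' : Fin n := ⟨v + 1, by omega⟩
    have e : {x | v ≤ x} = insert v {x | v' ≤ x} := by
      ext x
      simp only [Set.mem_ofPred_eq, Set.mem_insert_iff, Fin.le_def, Fin.ext_iff, v']
      omega
    have hl : M.IsLeaf {x | v' ≤ x} v v' := by
      refine ⟨?_, (hc v v' hcv (by simp [Fin.lt_def, v'])).2 rfl, fun x hx h => ?_⟩
      · simp [Fin.le_def, v']
      · simp only [Set.mem_ofPred_eq, Fin.le_def, v'] at hx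
        have := (hc v x hcv (by rw [Fin.lt_def]; omega)).1 h
        ext
        simp [v', this]
    rw [e]
    exact (ih v' (by simp only [v']; omega) (by simp only [v']; omega)).insert_leaf _ hM hl

theorem isSimplyLaced_A (n : ℕ) : (CoxeterMatrix.A n).IsSimplyLaced := by
  intro i j hij
  simp only [CoxeterMatrix.A, Matrix.of_apply, hij, if_false]
  split_ifs <;> simp

theorem isSimplyLaced_typeD (n : ℕ) : (typeD n).IsSimplyLaced := by
  intro i j hij
  simp only [typeD, Matrix.of_apply, hij, if_false]
  split_ifs <;> simp

theorem isSimplyLaced_typeE (n : ℕ) : (typeE n).IsSimplyLaced := by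
  intro i j hij
  simp only [typeE, Matrix.of_apply, hij, if_false]
  split_ifs <;> simp

theorem typeD_eq_three_iff {n : ℕ} {i j : Fin n} : typeD n i j = 3 ↔ i ≠ j ∧
    (((i : ℕ) = 0 ∧ (j : ℕ) = 2) ∨ ((j : ℕ) = 0 ∧ (i : ℕ) = 2) ∨
      (1 ≤ (i : ℕ) ∧ (i : ℕ) + 1 = j) ∨ (1 ≤ (j : ℕ) ∧ (j : ℕ) + 1 = i)) := by
  simp only [typeD, Matrix.of_apply]
  split_ifs with h1 h2
  · simp [h1]
  · simp [h1, h2]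
  · exact iff_of_false (by norm_num) fun h => h2 h.2

theorem typeE_eq_three_iff {n : ℕ} {i j : Fin n} : typeE n i j = 3 ↔ i ≠ j ∧
    (((i : ℕ) = 0 ∧ (j : ℕ) = 2) ∨ ((j : ℕ) = 0 ∧ (i : ℕ) = 2) ∨
      ((i : ℕ) = 1 ∧ (j : ℕ) = 3) ∨ ((j : ℕ) = 1 ∧ (i : ℕ) = 3) ∨
      (2 ≤ (i : ℕ) ∧ (i : ℕ) + 1 = j) ∨ (2 ≤ (j : ℕ) ∧ (j : ℕ) + 1 = i)) := by
  simp only [typeE, Matrix.of_apply]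
  split_ifs with h1 h2
  · simp [h1]
  · simp [h1, h2]
  · exact iff_of_false (by norm_num) fun h => h2 h.2

theorem contentMaximal_A (k : ℕ) : (CoxeterMatrix.A (k + 1)).contentMaximalSet.Finite ∧
    (CoxeterMatrix.A (k + 1)).numContentMaximal =
      (pathCount k).1 + (pathCount k).2.1 + (pathCount k).2.2 := by
  have h := hasStateCount_path (isSimplyLaced_A (k + 1)) (c := 0) (fun x y _ hxy => by
    simp only [CoxeterMatrix.A, Matrix.of_apply, Fin.ext_iff]
    rw [Fin.lt_def] at hxy
    split_ifs <;> simp <;> omega) k 0 (by simp) (by simp)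
  have e : {x : Fin (k + 1) | 0 ≤ x} = Set.univ := by
    ext
    simp
  rw [e] at h
  exact finite_contentMaximalSet_of_hasStateCount (isSimplyLaced_A _) h

/-- Two leaves at the end vertex `2` of the path change its counts `(a, u, m)` to `(2a, 3u, 3m + u)`
and then to `(4a, 9u, 9m + 6u)`, with sum `4a + 15u + 9m`. -/
theorem contentMaximal_typeD (k : ℕ) : (typeD (k + 4)).contentMaximalSet.Finite ∧
    (typeD (k + 4)).numContentMaximal = 4 * (pathCount (k + 1)).1 +
      15 * (pathCount (k + 1)).2.1 + 9 * (pathCount (k + 1)).2.2 := by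
  have hM := isSimplyLaced_typeD (k + 4)
  let v (i : ℕ) (h : i < k + 4 := by omega) : Fin (k + 4) := ⟨i, h⟩
  have h := hasStateCount_path hM (c := 2) (fun x y hx hxy => by
    rw [typeD_eq_three_iff, Ne, Fin.ext_iff]
    rw [Fin.lt_def] at hxy
    omega) (k + 1) (v 2) (by simp only [v]; omega) (by simp only [v]; omega)
  have l1 : (typeD (k + 4)).IsLeaf {x | v 2 ≤ x} (v 1) (v 2) := by
    refine ⟨?_, ?_, fun x hx h => ?_⟩
    · simp [v, Fin.lt_def]
    · simp [typeD_eq_three_iff, v]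
    · simp only [Set.mem_ofPred_eq, Fin.le_def, v] at hx
      simp only [typeD_eq_three_iff, v] at h
      ext
      simp only [v]
      omega
  have l0 : (typeD (k + 4)).IsLeaf (insert (v 1) {x | v 2 ≤ x}) (v 0) (v 2) := by
    refine ⟨?_, ?_, fun x hx h => ?_⟩
    · simp [v]
    · simp [typeD_eq_three_iff, v]
    · simp only [typeD_eq_three_iff, v] at h
      ext
      simp only [v]
      omega
  have h' := (h.insert_leaf_of_neighbour _ hM l1).insert_leaf_of_neighbour _ hM l0
  have e : insert (v 0) (insert (v 1) {x | v 2 ≤ x}) = Set.univ := by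
    ext x
    simp only [Set.mem_insert_iff, Set.mem_ofPred_eq, Fin.le_def, Fin.ext_iff, v, Set.mem_univ,
      iff_true]
    omega
  rw [e] at h'
  have := finite_contentMaximalSet_of_hasStateCount hM h'
  exact ⟨this.1, by rw [this.2]; ring⟩

/-- The leaf `1` changes the counts `(a, u, m)` at the vertex `3` to `(2a, 3u, 3m + u)`. Passing to
the leaf `2` gives `(2a + 4u + 3m, 2a + 8u + 6m, 3u)`. The last leaf `0` yields a total of twice the
first, four times the second and three times the third of these, that is `12a + 49u + 30m`. -/
theorem contentMaximal_typeE (k : ℕ) : (typeE (k + 6)).contentMaximalSet.Finite ∧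
    (typeE (k + 6)).numContentMaximal = 12 * (pathCount (k + 2)).1 +
      49 * (pathCount (k + 2)).2.1 + 30 * (pathCount (k + 2)).2.2 := by
  have hM := isSimplyLaced_typeE (k + 6)
  let v (i : ℕ) (h : i < k + 6 := by omega) : Fin (k + 6) := ⟨i, h⟩
  have h := hasStateCount_path hM (c := 3) (fun x y hx hxy => by
    rw [typeE_eq_three_iff, Ne, Fin.ext_iff]
    rw [Fin.lt_def] at hxy
    omega) (k + 2) (v 3) (by simp only [v]; omega) (by simp only [v]; omega)
  have l1 : (typeE (k + 6)).IsLeaf {x | v 3 ≤ x} (v 1) (v 3) := by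
    refine ⟨?_, ?_, fun x hx h => ?_⟩
    · simp [v, Fin.lt_def]
    · simp [typeE_eq_three_iff, v]
    · simp only [Set.mem_ofPred_eq, Fin.le_def, v] at hx
      simp only [typeE_eq_three_iff, v] at h
      ext
      simp only [v]
      omega
  have l2 : (typeE (k + 6)).IsLeaf (insert (v 1) {x | v 3 ≤ x}) (v 2) (v 3) := by
    refine ⟨?_, ?_, fun x hx h => ?_⟩
    · simp [v]
    · simp [typeE_eq_three_iff, v]
    · simp only [Set.mem_insert_iff, Set.mem_ofPred_eq, Fin.le_def, Fin.ext_iff, v] at hx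
      simp only [typeE_eq_three_iff, v] at h
      ext
      simp only [v]
      omega
  have l0 : (typeE (k + 6)).IsLeaf (insert (v 2) (insert (v 1) {x | v 3 ≤ x})) (v 0) (v 2) := by
    refine ⟨?_, ?_, fun x hx h => ?_⟩
    · simp [v]
    · simp [typeE_eq_three_iff, v]
    · simp only [typeE_eq_three_iff, v] at h
      ext
      simp only [v]
      omega
  have h' := ((h.insert_leaf_of_neighbour _ hM l1).insert_leaf _ hM l2).insert_leaf _ hM l0
  have e : insert (v 0) (insert (v 2) (insert (v 1) {x | v 3 ≤ x})) = Set.univ := by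
    ext x
    simp only [Set.mem_insert_iff, Set.mem_ofPred_eq, Fin.le_def, Fin.ext_iff, v, Set.mem_univ,
      iff_true]
    omega
  rw [e] at h'
  have := finite_contentMaximalSet_of_hasStateCount hM h'
  exact ⟨this.1, by rw [this.2]; ring⟩

end CoxeterMatrix

/-! ### Generating functions -/

/-- The generating function of a sequence with `a (n + 3) = 3 a (n + 2) + a (n + 1) - a n`. -/
theorem ogfFrom_eq (n₀ : ℕ) (f : ℕ → ℕ) (c₀ c₁ c₂ : ℚ) (h₀ : (f n₀ : ℚ) = c₀)
    (h₁ : (f (n₀ + 1) : ℚ) = 3 * f n₀ + c₁)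
    (h₂ : (f (n₀ + 2) : ℚ) = 3 * f (n₀ + 1) + f n₀ + c₂)
    (hf : ∀ k, f (n₀ + k + 3) + f (n₀ + k) = 3 * f (n₀ + k + 2) + f (n₀ + k + 1)) :
    ogfFrom n₀ f = PowerSeries.X ^ n₀ * (PowerSeries.C c₀ + PowerSeries.C c₁ * PowerSeries.X ^ 1 +
        PowerSeries.C c₂ * PowerSeries.X ^ 2) *
      (1 - 3 * PowerSeries.X - PowerSeries.X ^ 2 + PowerSeries.X ^ 3)⁻¹ := by
  rw [PowerSeries.eq_mul_inv_iff_mul_eq (by simp)]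
  have e : ogfFrom n₀ f = PowerSeries.X ^ n₀ * PowerSeries.mk fun k => (f (n₀ + k) : ℚ) := by
    ext n
    rw [ogfFrom, PowerSeries.coeff_mk, PowerSeries.coeff_X_pow_mul']
    split_ifs with h
    · rw [PowerSeries.coeff_mk, Nat.add_sub_cancel' h]
    · rfl
  rw [e, mul_assoc]
  congr 1
  generalize hG : PowerSeries.mk (fun k => (f (n₀ + k) : ℚ)) = G
  have hc (k : ℕ) : PowerSeries.coeff k G = f (n₀ + k) := by rw [← hG, PowerSeries.coeff_mk]
  -- Each summand is a constant or a power of `X` times `G`, so its coefficients are shifted values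
  -- of `f`. From degree `3` on they cancel by the recurrence, and the lower ones give `c₀, c₁, c₂`.
  have e2 : G * (1 - 3 * PowerSeries.X - PowerSeries.X ^ 2 + PowerSeries.X ^ 3) =
      G - PowerSeries.C 3 * (PowerSeries.X ^ 1 * G) - PowerSeries.X ^ 2 * G +
        PowerSeries.X ^ 3 * G := by
    rw [map_ofNat]
    ring
  rw [e2]
  ext n
  rw [map_add, map_sub, map_sub, map_add, map_add]
  simp only [PowerSeries.coeff_C_mul, PowerSeries.coeff_X_pow_mul', PowerSeries.coeff_X_pow,
    PowerSeries.coeff_C, hc]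
  match n with
  | 0 => simpa using h₀
  | 1 => simp [h₁]
  | 2 =>
    simp [h₂]
    ring
  | k + 3 =>
    have h' : (f (n₀ + k + 3) : ℚ) + f (n₀ + k) = 3 * f (n₀ + k + 2) + f (n₀ + k + 1) := by
      exact_mod_cast hf k
    simp [← add_assoc]
    linarith

theorem theorem4p2 :
    -- type `A n`, `n ≥ 1`
    ((∀ n : ℕ, 1 ≤ n → (CoxeterMatrix.A n).contentMaximalSet.Finite) ∧
      ogfFrom 1 (fun n => (CoxeterMatrix.A n).numContentMaximal) =
        (2 * PowerSeries.X - PowerSeries.X ^ 3) *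
          (1 - 3 * PowerSeries.X - PowerSeries.X ^ 2 + PowerSeries.X ^ 3)⁻¹ ∧
      (CoxeterMatrix.A 1).numContentMaximal = 2 ∧
      (CoxeterMatrix.A 2).numContentMaximal = 6 ∧
      (CoxeterMatrix.A 3).numContentMaximal = 19 ∧
      (CoxeterMatrix.A 4).numContentMaximal = 61 ∧
      (CoxeterMatrix.A 5).numContentMaximal = 196) ∧
    -- type `D n`, `n ≥ 4`
    ((∀ n : ℕ, 4 ≤ n → (CoxeterMatrix.typeD n).contentMaximalSet.Finite) ∧
      ogfFrom 4 (fun n => (CoxeterMatrix.typeD n).numContentMaximal) =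
        (62 * PowerSeries.X ^ 4 + 15 * PowerSeries.X ^ 5 - 19 * PowerSeries.X ^ 6) *
          (1 - 3 * PowerSeries.X - PowerSeries.X ^ 2 + PowerSeries.X ^ 3)⁻¹ ∧
      (CoxeterMatrix.typeD 4).numContentMaximal = 62 ∧
      (CoxeterMatrix.typeD 5).numContentMaximal = 201 ∧
      (CoxeterMatrix.typeD 6).numContentMaximal = 646 ∧
      (CoxeterMatrix.typeD 7).numContentMaximal = 2077) ∧
    -- type `E n`, `n ≥ 6`
    ((∀ n : ℕ, 6 ≤ n → (CoxeterMatrix.typeE n).contentMaximalSet.Finite) ∧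
      ogfFrom 6 (fun n => (CoxeterMatrix.typeE n).numContentMaximal) =
        (652 * PowerSeries.X ^ 6 + 140 * PowerSeries.X ^ 7 - 201 * PowerSeries.X ^ 8) *
          (1 - 3 * PowerSeries.X - PowerSeries.X ^ 2 + PowerSeries.X ^ 3)⁻¹ ∧
      (CoxeterMatrix.typeE 6).numContentMaximal = 652 ∧
      (CoxeterMatrix.typeE 7).numContentMaximal = 2096 ∧
      (CoxeterMatrix.typeE 8).numContentMaximal = 6739) := by
  have hA := fun k => (contentMaximal_A k).2
  have hD := fun k => (contentMaximal_typeD k).2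
  have hE := fun k => (contentMaximal_typeE k).2
  have a1 : (CoxeterMatrix.A 1).numContentMaximal = 2 := by rw [hA 0]; rfl
  have a2 : (CoxeterMatrix.A 2).numContentMaximal = 6 := by rw [hA 1]; rfl
  have a3 : (CoxeterMatrix.A 3).numContentMaximal = 19 := by rw [hA 2]; rfl
  have d4 : (typeD 4).numContentMaximal = 62 := by rw [hD 0]; rfl
  have d5 : (typeD 5).numContentMaximal = 201 := by rw [hD 1]; rfl
  have d6 : (typeD 6).numContentMaximal = 646 := by rw [hD 2]; rfl
  have e6 : (typeE 6).numContentMaximal = 652 := by rw [hE 0]; rfl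
  have e7 : (typeE 7).numContentMaximal = 2096 := by rw [hE 1]; rfl
  have e8 : (typeE 8).numContentMaximal = 6739 := by rw [hE 2]; rfl
  refine ⟨⟨fun n hn => ?_, ?_, a1, a2, a3, by rw [hA 3]; rfl, by rw [hA 4]; rfl⟩,
    ⟨fun n hn => ?_, ?_, d4, d5, d6, by rw [hD 3]; rfl⟩, ⟨fun n hn => ?_, ?_, e6, e7, e8⟩⟩
  · obtain ⟨k, rfl⟩ := Nat.exists_eq_add_of_le' hn
    exact (contentMaximal_A k).1
  -- The numerator comes from the initial values: `2`, `6 - 3·2 = 0` and `19 - 3·6 - 2 = -1`. Types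
  -- `D` and `E` are treated in the same way.
  · rw [ogfFrom_eq 1 _ 2 0 (-1) (by norm_num [a1, a2, a3]) (by norm_num [a1, a2, a3])
      (by norm_num [a1, a2, a3]) fun k => ?_]
    · simp only [map_neg, map_ofNat, map_zero, map_one]
      ring
    · have := pathCount_recurrence 1 1 1 k
      simp only [one_mul] at this
      rw [add_comm 1 k, hA k, hA (k + 1), hA (k + 2), hA (k + 3)]
      exact this
  · obtain ⟨k, rfl⟩ := Nat.exists_eq_add_of_le' hn
    exact (contentMaximal_typeD k).1
  · rw [ogfFrom_eq 4 _ 62 15 (-19) (by norm_num [d4, d5, d6]) (by norm_num [d4, d5, d6])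
      (by norm_num [d4, d5, d6]) fun k => ?_]
    · simp only [map_neg, map_ofNat]
      ring
    -- The recurrence holds for every linear form in the path counts, so the branch contributes only
    -- the weights; the shift is the length of the remaining path.
    · have := pathCount_recurrence 4 15 9 (k + 1)
      rw [add_comm 4 k, hD k, show k + 4 + 1 = k + 1 + 4 by ring, hD (k + 1),
        show k + 4 + 2 = k + 2 + 4 by ring, hD (k + 2), show k + 4 + 3 = k + 3 + 4 by ring,
        hD (k + 3)]
      exact this
  · obtain ⟨k, rfl⟩ := Nat.exists_eq_add_of_le' hn
    exact (contentMaximal_typeE k).1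
  · rw [ogfFrom_eq 6 _ 652 140 (-201) (by norm_num [e6, e7, e8]) (by norm_num [e6, e7, e8])
      (by norm_num [e6, e7, e8]) fun k => ?_]
    · simp only [map_neg, map_ofNat]
      ring
    · have := pathCount_recurrence 12 49 30 (k + 2)
      rw [add_comm 6 k, hE k, show k + 6 + 1 = k + 1 + 6 by ring, hE (k + 1),
        show k + 6 + 2 = k + 2 + 6 by ring, hE (k + 2), show k + 6 + 3 = k + 3 + 6 by ring,
        hE (k + 3)]
      exact this

end
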